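/- Let $\mathfrak o$ be a compact discrete valuation ring with uniformizer $\pi$ and residue field of cardinality $q$, let $n\ge 2$ and let $1\le\iota\le n-1$. View $\mathfrak o^n$ as an $\mathfrak o$-algebra under componentwise multiplication. For $r_0\ge 0$ and $r\ge 1$ let $h_n(\{\iota\},r_0,r)$ be the number of finite-index $\mathfrak o$-submodules $\Lambda\le\mathfrak o^n$ that are closed under multiplication (and need not contain the identity) and have elementary divisor type $(\{\iota\},r_0,r)$, that is, such that $\Lambda$ is generated by the rows of $\pi^{r_0}\operatorname{diag}(\underbrace{\pi^{r},\dots,\pi^{r}}_{\iota},\underbrace{1,\dots,1}_{n-\iota})\,A$ for some $A\in\mathrm{GL}_n(\mathfrak o)$. For $s_0,s_\iota\in\mathbb C$ put $$\Xi_{n,\{\iota\}}(s_0,s_\iota)=\sum_{r_0\ge 0,\ r\ge 1} q^{-ns_0r_0-\iota s_\iota r}\,h_n(\{\iota\},r_0,r).$$ This series converges absolutely if and only if $\operatorname{Re}(s_0)>0$, $\operatorname{Re}(s_\iota)>0$ and $n\operatorname{Re}(s_0)+\iota\operatorname{Re}(s_\iota)>\iota(n-\iota)$, and then $$\Xi_{n,\{\iota\}}(s_0,s_\iota)=\frac{q^{-\iota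 s_\iota}}{1-q^{-ns_0-\iota s_\iota+\iota(n-\iota)}}\left(\binom{n}{\iota}_q\frac{q^{-ns_0}}{1-q^{-ns_0}}+\theta_{n,\iota}\frac{1}{1-q^{-\iota s_\iota}}\right),$$ where $\binom{n}{\iota}_q=\prod_{i=0}^{\iota-1}\frac{1-q^{n-i}}{1-q^{\iota-i}}$ and $\theta_{n,\iota}$ is the coefficient of $z^\iota$ in the power series expansion of $\prod_{i=1}^{n-\iota+1}\frac{1}{1-iz}$. -/

import Mathlib

namespace CotypeZeta

/-- The matrix `D(I, r)`. Its `k`-th diagonal entry, for `k = 1, …, n`, is `π` raised to the sum of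
the `r i` over all `i ∈ I` with `k ≤ i`. Rows are indexed here by `Fin n`, that is from `0`, so the
condition `k ≤ i` reads `(k : ℕ) < i`. -/
def divisorMatrix {O : Type*} [CommRing O] (π : O) (n : ℕ) (I : Finset ℕ) (r : I → ℕ+) :
    Matrix (Fin n) (Fin n) O :=
  Matrix.diagonal fun k => π ^ (∑ i : I, if (k : ℕ) < (i : ℕ) then (r i : ℕ) else 0)

/-- The submodule of `O ^ n` generated by the rows of a matrix. -/
def rowSpan {O : Type*} [CommRing O] {n : ℕ} (M : Matrix (Fin n) (Fin n) O) :
    Submodule O (Fin n → O) :=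
  Submodule.span O (Set.range M.row)

/-- `Λ` has elementary divisor type `(I, r₀, r)`: it is the row span of `π ^ r₀ D(I, r) A` for some
`A` in `GL_n(O)`. -/
def HasType {O : Type*} [CommRing O] (π : O) {n : ℕ} (I : Finset ℕ) (r₀ : ℕ) (r : I → ℕ+)
    (Λ : Submodule O (Fin n → O)) : Prop :=
  ∃ A : GL (Fin n) O, Λ = rowSpan (π ^ r₀ • (divisorMatrix π n I r * (A : Matrix (Fin n) (Fin n) O)))

/-- `Λ` is a submodule of `O ^ n` of finite index that is closed under the componentwise
multiplication. It need not contain the identity. -/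
def IsFiniteIndexSubalgebra {O : Type*} [CommRing O] {n : ℕ} (Λ : Submodule O (Fin n → O)) : Prop :=
  Finite ((Fin n → O) ⧸ Λ) ∧ ∀ x ∈ Λ, ∀ y ∈ Λ, x * y ∈ Λ

/-- The number of finite-index subalgebras of `O ^ n` of elementary divisor type `(I, r₀, r)`. -/
noncomputable def typeCount {O : Type*} [CommRing O] (π : O) (n : ℕ) (I : Finset ℕ) (r₀ : ℕ)
    (r : I → ℕ+) : ℕ :=
  Set.ncard {Λ : Submodule O (Fin n → O) | IsFiniteIndexSubalgebra Λ ∧ HasType π I r₀ r Λ}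

/-- The cardinality of the residue field. -/
noncomputable def residueCard (O : Type*) [CommRing O] [IsLocalRing O] : ℕ :=
  Nat.card (IsLocalRing.ResidueField O)

/-- The term of the series `Ξ_{n,I}(s₀, s)` with index `(r₀, r)`. -/
noncomputable def xiTerm {O : Type*} [CommRing O] [IsLocalRing O] (π : O) (n : ℕ) (I : Finset ℕ)
    (s₀ : ℂ) (s : I → ℂ) (p : ℕ × (I → ℕ+)) : ℂ :=
  (residueCard O : ℂ) ^ (-(s₀ * n * p.1) - ∑ i : I, ((p.2 i : ℕ) : ℂ) * ((i : ℕ) : ℂ) * s i) *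
    (typeCount π n I p.1 p.2 : ℂ)

/-- The series `Ξ_{n,I}(s₀, s)`, summed over all `r₀ ≥ 0` and all `r` with positive entries. -/
noncomputable def xi {O : Type*} [CommRing O] [IsLocalRing O] (π : O) (n : ℕ) (I : Finset ℕ)
    (s₀ : ℂ) (s : I → ℂ) : ℂ :=
  ∑' p : ℕ × (I → ℕ+), xiTerm π n I s₀ s p

/-- The value at `x` of the Gaussian polynomial; used only for `r ≤ n` and `x` an integer `≥ 2`,
where no denominator vanishes. -/
noncomputable def gaussianBinomial (n r : ℕ) (x : ℂ) : ℂ :=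
  ∏ i ∈ Finset.range r, (1 - x ^ (n - i)) / (1 - x ^ (r - i))

/-- The coefficient of `z ^ ι` in the product of the power series `1 / (1 - i z)` over
`i = 1, …, n - ι + 1`. -/
noncomputable def theta (n ι : ℕ) : ℚ :=
  PowerSeries.coeff ι
    (∏ i ∈ Finset.Icc 1 (n - ι + 1), (1 - (i : PowerSeries ℚ) * PowerSeries.X)⁻¹)

end CotypeZeta

/-! Write `Λ = π ^ r₀ Λ'` with `Λ'` of type `({ι}, 0, r)`. Such `Λ'` are exactly the kernels of
surjections `φ : O ^ n → (O / π ^ r) ^ ι`, and each arises from as many surjections as the target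
has automorphisms. Closedness of `Λ` means `π ^ r₀ Λ' Λ' ⊆ Λ'`.

If `r ≤ r₀` this is automatic, and counting surjections gives the Gaussian binomial times `q ^ ((r -
1) ι (n - ι))` (`typeCount_of_le`). If `r₀ < r`, put `m = r - r₀`: the condition says that the
kernel of `φ` modulo `π ^ m` is multiplicatively closed, so the count is `q ^ (r₀ ι (n - ι))` times
the number of closed kernels of level `m` (`typeCount_of_lt`).

That last number does not depend on `m` or on `O`. Taking powers of vectors, a closed kernel
contains the characteristic vectors of certain sets of coordinates; these separate the coordinates
that `Λ` distinguishes modulo the maximal ideal. Hence it is cut out by congruences `x i ≡ x j` and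
`x i ≡ 0` modulo `π ^ m`, that is, by an equivalence relation on the `n` coordinates and one extra
point standing for zero (`card_isMulClosed`). The relations needed have `n - ι + 1` classes, so they
are counted by the Stirling number `S(n + 1, n - ι + 1)`, which is `theta n ι`. The series then
splits along `r ≤ r₀` and `r₀ < r` into two products of geometric series
(`summable_iff_and_hasSum_of_diagonal`). -/

namespace CotypeZeta

open IsLocalRing

/-! ### Reduction modulo powers and Nakayama. -/

section Truncation

variable {O : Type*} [CommRing O]

/-- Coordinatewise reduction `(O / I) ^ κ → (O / J) ^ κ` for ideals `I ≤ J`. -/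
def reducePi (κ : Type*) {I J : Ideal O} (h : I ≤ J) : (κ → O ⧸ I) →ₗ[O] (κ → O ⧸ J) :=
  (Submodule.factor h).compLeft κ

/-- Coordinatewise reduction `O ^ κ → (O / J) ^ κ`. -/
def mkPi (κ : Type*) (J : Ideal O) : (κ → O) →ₗ[O] (κ → O ⧸ J) :=
  (Submodule.mkQ J).compLeft κ

@[simp]
lemma mkPi_apply {κ : Type*} (J : Ideal O) (x : κ → O) (i : κ) :
    mkPi κ J x i = Ideal.Quotient.mk J (x i) := rfl

lemma mkPi_surjective (κ : Type*) (J : Ideal O) : Function.Surjective (mkPi κ J) :=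
  Function.Surjective.comp_left (Submodule.mkQ_surjective J)

lemma mkPi_eq_zero {κ : Type*} {J : Ideal O} {x : κ → O} : mkPi κ J x = 0 ↔ ∀ i, x i ∈ J := by
  simp [funext_iff, Ideal.Quotient.eq_zero_iff_mem]

lemma reducePi_surjective (κ : Type*) {I J : Ideal O} (h : I ≤ J) :
    Function.Surjective (reducePi κ h) :=
  Function.Surjective.comp_left (Submodule.factor_surjective h)

lemma reducePi_mkPi {κ : Type*} {I J : Ideal O} (h : I ≤ J) (x : κ → O) :
    reducePi κ h (mkPi κ I x) = mkPi κ J x := rfl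

/-- A form of Nakayama's lemma. -/
lemma surjective_of_comp_surjective [IsLocalRing O] {P N N' : Type*} [AddCommGroup P]
    [AddCommGroup N] [AddCommGroup N'] [Module O P] [Module O N] [Module O N'] [Module.Finite O N]
    (f : N →ₗ[O] N') (hf : f.ker ≤ maximalIdeal O • (⊤ : Submodule O N)) (φ : P →ₗ[O] N)
    (h : Function.Surjective (f ∘ₗ φ)) : Function.Surjective φ := by
  rw [← LinearMap.range_eq_top, eq_top_iff]
  refine Submodule.le_of_le_smul_of_le_jacobson_bot (Module.finite_def.mp ‹_›)
    (maximalIdeal_le_jacobson _) fun x _ => ?_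
  obtain ⟨p, hp⟩ := h (f x)
  have hx : x - φ p ∈ f.ker := by
    rw [LinearMap.mem_ker, map_sub, ← hp]
    simp
  rw [show x = φ p + (x - φ p) by abel]
  exact Submodule.add_mem_sup ⟨p, rfl⟩ (hf hx)

lemma ker_mkPi_le {κ : Type*} [Finite κ] {J K : Ideal O} (hJ : J ≤ K) :
    (mkPi κ J).ker ≤ K • (⊤ : Submodule O (κ → O)) := by
  classical
  have := Fintype.ofFinite κ
  intro x hx
  rw [LinearMap.mem_ker, mkPi_eq_zero] at hx
  rw [pi_eq_sum_univ' x]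
  refine Submodule.sum_mem _ fun i _ => ?_
  exact Submodule.smul_mem_smul (hJ (hx i)) trivial

lemma ker_reducePi_le {κ : Type*} [Finite κ] {I J K : Ideal O} (h : I ≤ J) (hJ : J ≤ K) :
    (reducePi κ h).ker ≤ K • (⊤ : Submodule O (κ → O ⧸ I)) := by
  intro x hx
  obtain ⟨y, rfl⟩ := mkPi_surjective κ I x
  have hy : y ∈ (mkPi κ J).ker := hx
  have := Submodule.mem_map_of_mem (f := mkPi κ I) (ker_mkPi_le hJ hy)
  rw [Submodule.map_smul''] at this
  exact Submodule.smul_mono le_rfl le_top this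

/-- The kernel of the reduction lies in the maximal ideal times the module, so Nakayama applies.
Surjectivity can therefore be tested over the residue field. -/
lemma surjective_reducePi_comp_iff [IsLocalRing O] {P κ : Type*} [Finite κ] [AddCommGroup P]
    [Module O P] {I J : Ideal O} (h : I ≤ J) (hJ : J ≤ maximalIdeal O)
    (φ : P →ₗ[O] (κ → O ⧸ I)) :
    Function.Surjective (reducePi κ h ∘ₗ φ) ↔ Function.Surjective φ :=
  ⟨surjective_of_comp_surjective _ (ker_reducePi_le h hJ) φ,
    fun hφ => (reducePi_surjective κ h).comp hφ⟩

/-- Every surjection onto `(O / J) ^ κ` lifts to a surjection onto `O ^ κ`. -/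
lemma exists_surjective_lift [IsLocalRing O] {P κ : Type*} [Finite κ] [AddCommGroup P]
    [Module O P] [Module.Projective O P] {J : Ideal O} (hJ : J ≤ maximalIdeal O)
    (φ : P →ₗ[O] (κ → O ⧸ J)) (hφ : Function.Surjective φ) :
    ∃ M : P →ₗ[O] (κ → O), Function.Surjective M ∧ mkPi κ J ∘ₗ M = φ := by
  obtain ⟨M, hM⟩ := Module.projective_lifting_property (mkPi κ J) φ (mkPi_surjective κ J)
  refine ⟨M, ?_, hM⟩
  exact surjective_of_comp_surjective (mkPi κ J) (ker_mkPi_le hJ) M (by rwa [hM])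

end Truncation

/-! ### Counting homomorphisms and kernels. -/

section Counting

variable {O : Type*} [CommRing O]

/-- Counting homomorphisms with a property that only depends on their reduction. -/
lemma card_comp_mul_card {P N N' : Type*} [AddCommGroup P] [AddCommGroup N] [AddCommGroup N']
    [Module O P] [Module O N] [Module O N'] [Module.Projective O P] (f : N →ₗ[O] N')
    (hf : Function.Surjective f) (p : (P →ₗ[O] N') → Prop) :
    Nat.card {φ : P →ₗ[O] N // p (f ∘ₗ φ)} * Nat.card (P →ₗ[O] N') =
      Nat.card {ψ : P →ₗ[O] N' // p ψ} * Nat.card (P →ₗ[O] N) := by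
  let F : (P →ₗ[O] N) →ₗ[O] (P →ₗ[O] N') := LinearMap.compRight O f
  have hF : Function.Surjective F := fun ψ => Module.projective_lifting_property f ψ hf
  obtain ⟨σ, hσ⟩ := hF.hasRightInverse
  -- Each fibre of `F` is a coset of `F.ker`; `σ` picks base points. Applying this also to the
  -- trivial property removes the size of `F.ker` from the final identity.
  have key : ∀ p : (P →ₗ[O] N') → Prop, Nat.card {φ : P →ₗ[O] N // p (f ∘ₗ φ)} =
      Nat.card {ψ : P →ₗ[O] N' // p ψ} * Nat.card F.ker := by
    intro p
    rw [← Nat.card_prod]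
    refine Nat.card_congr
      ⟨fun φ => ⟨⟨F φ.1, φ.2⟩, ⟨φ.1 - σ (F φ.1), ?_⟩⟩, fun a => ⟨σ a.1.1 + a.2.1, ?_⟩, ?_, ?_⟩
    · rw [LinearMap.mem_ker, map_sub, hσ, sub_self]
    · have : f ∘ₗ (σ a.1.1 + a.2.1) = a.1.1 := by
        change F (σ a.1.1 + a.2.1) = _
        rw [map_add, hσ, LinearMap.mem_ker.mp a.2.2, add_zero]
      rw [this]
      exact a.1.2
    · intro φ
      ext1
      simp
    · rintro ⟨⟨ψ, hψ⟩, ⟨κ, hκ⟩⟩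
      have : F (σ ψ + κ) = ψ := by rw [map_add, hσ, LinearMap.mem_ker.mp hκ, add_zero]
      simp [this]
  have h1 := key fun _ => True
  have h2 : Nat.card (P →ₗ[O] N) = Nat.card (P →ₗ[O] N') * Nat.card F.ker := by
    rw [← Nat.card_congr (Equiv.subtypeUnivEquiv (p := fun _ : P →ₗ[O] N => True) (by simp)), h1,
      Nat.card_congr (Equiv.subtypeUnivEquiv (p := fun _ : P →ₗ[O] N' => True) (by simp))]
  rw [key p, h2]
  ring

lemma card_linearMap_pi (n : ℕ) (κ : Type*) [Fintype κ] (J : Ideal O) :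
    Nat.card ((Fin n → O) →ₗ[O] (κ → O ⧸ J)) = Nat.card (O ⧸ J) ^ (n * Fintype.card κ) := by
  rw [← Nat.card_congr ((Pi.basisFun O (Fin n)).constr ℕ (M' := κ → O ⧸ J)).toEquiv]
  simp only [Nat.card_fun, Nat.card_eq_fintype_card, Fintype.card_fin]
  rw [← pow_mul, mul_comm]

/-- Surjections with the same kernel differ by an automorphism of the target. -/
noncomputable def surjectiveKerEquiv {P N : Type*} [AddCommGroup P] [AddCommGroup N]
    [Module O P] [Module O N] (φ₀ : P →ₗ[O] N) (h₀ : Function.Surjective φ₀) :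
    {φ : P →ₗ[O] N // Function.Surjective φ ∧ φ.ker = φ₀.ker} ≃ (N ≃ₗ[O] N) where
  toFun φ := (φ₀.quotKerEquivOfSurjective h₀).symm ≪≫ₗ
    Submodule.quotEquivOfEq _ _ φ.2.2.symm ≪≫ₗ φ.1.quotKerEquivOfSurjective φ.2.1
  invFun g := ⟨g.toLinearMap ∘ₗ φ₀, g.surjective.comp h₀, by ext; simp⟩
  left_inv φ := by
    ext1
    refine LinearMap.ext fun x => ?_
    have : (φ₀.quotKerEquivOfSurjective h₀).symm (φ₀ x) = Submodule.Quotient.mk x := by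
      rw [LinearEquiv.symm_apply_eq]; rfl
    simp [this]
  right_inv g := by
    ext y
    obtain ⟨x, rfl⟩ := h₀ y
    have : (φ₀.quotKerEquivOfSurjective h₀).symm (φ₀ x) = Submodule.Quotient.mk x := by
      rw [LinearEquiv.symm_apply_eq]; rfl
    simp [this]

/-- Counting surjections by their kernels. -/
lemma card_surjective_eq {P N : Type*} [AddCommGroup P] [AddCommGroup N]
    [Module O P] [Module O N] (p : Submodule O P → Prop) :
    Nat.card {φ : P →ₗ[O] N // Function.Surjective φ ∧ p φ.ker} =
      Nat.card {Λ : Submodule O P // (∃ φ : P →ₗ[O] N, Function.Surjective φ ∧ φ.ker = Λ) ∧ p Λ} *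
        Nat.card (N ≃ₗ[O] N) := by
  rw [← Nat.card_prod]
  let F : {φ : P →ₗ[O] N // Function.Surjective φ ∧ p φ.ker} →
    {Λ : Submodule O P // (∃ φ : P →ₗ[O] N, Function.Surjective φ ∧ φ.ker = Λ) ∧ p Λ} :=
    fun φ => ⟨φ.1.ker, ⟨φ.1, φ.2.1, rfl⟩, φ.2.2⟩
  refine Nat.card_congr ((Equiv.sigmaFiberEquiv F).symm.trans
    ((Equiv.sigmaCongrRight fun Λ => ?_).trans (Equiv.sigmaEquivProd _ _)))
  -- One chosen surjection with kernel `Λ` serves as base point, which makes the fibre over `Λ` a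
  -- copy of the automorphism group.
  refine Equiv.trans ?_ (surjectiveKerEquiv Λ.2.1.choose Λ.2.1.choose_spec.1)
  refine ⟨fun φ => ⟨φ.1.1, φ.1.2.1, ?_⟩, fun φ => ⟨⟨φ.1, φ.2.1, ?_⟩, ?_⟩, fun _ => rfl, fun _ => rfl⟩
  · rw [Λ.2.1.choose_spec.2]
    exact congrArg Subtype.val φ.2
  · rw [φ.2.2, Λ.2.1.choose_spec.2]
    exact Λ.2.2
  · exact Subtype.ext (φ.2.2.trans Λ.2.1.choose_spec.2)

end Counting

/-! ### Surjections over the residue field. -/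

section Field

lemma span_row_eq_top_iff_linearIndependent_col {m n F : Type*} [Fintype m] [Fintype n] [Field F]
    (M : Matrix m n F) :
    Submodule.span F (Set.range M.row) = ⊤ ↔ LinearIndependent F M.col := by
  rw [linearIndependent_iff_card_eq_finrank_span, Set.finrank, ← Matrix.rank_eq_finrank_span_cols,
    Matrix.rank_eq_finrank_span_row]
  constructor
  · intro h
    rw [h, finrank_top, Module.finrank_fintype_fun_eq_card]
  · intro h
    apply Submodule.eq_top_of_finrank_eq
    rw [← h, Module.finrank_fintype_fun_eq_card]

/-- A homomorphism is an `n × ι` matrix whose rows are the images of the basis vectors. It is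
surjective iff its `ι` columns are linearly independent in `F ^ n`, and independent families are
counted by `card_linearIndependent`. -/
lemma card_surjective_field {O F : Type*} [CommRing O] [Field F] [Finite F] [Algebra O F]
    (hF : Function.Surjective (algebraMap O F)) {n ι : ℕ} (h : ι ≤ n) :
    Nat.card {φ : (Fin n → O) →ₗ[O] (Fin ι → F) // Function.Surjective φ} =
      ∏ i : Fin ι, (Nat.card F ^ n - Nat.card F ^ (i : ℕ)) := by
  have := Fintype.ofFinite F
  have key := card_linearIndependent (K := F) (V := Fin n → F) (k := ι) (by simpa using h)
  rw [Module.finrank_fintype_fun_eq_card, Fintype.card_fin, ← Nat.card_eq_fintype_card] at key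
  rw [← key]
  symm
  refine Nat.card_congr (Equiv.subtypeEquiv ((Equiv.piComm _).trans
    ((Pi.basisFun O (Fin n)).constr ℕ (M' := Fin ι → F)).toEquiv) fun s => ?_)
  rw [← LinearMap.range_eq_top]
  have h1 : LinearMap.range ((Pi.basisFun O (Fin n)).constr ℕ (M' := Fin ι → F)
      ((Equiv.piComm _) s)) = Submodule.span O (Set.range (Matrix.of s).transpose.row) :=
    Module.Basis.constr_range _ _
  have h2 := span_row_eq_top_iff_linearIndependent_col (Matrix.of s).transpose
  change _ ↔ LinearIndependent F s at h2
  change _ ↔ LinearMap.range ((Pi.basisFun O (Fin n)).constr ℕ (M' := Fin ι → F)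
      ((Equiv.piComm _) s)) = ⊤
  rw [h1, ← h2, ← Submodule.restrictScalars_span O F hF, Submodule.restrictScalars_eq_top_iff]

end Field

/-! ### Surjections onto free modules over `O / π ^ r`. -/

section DVR

variable {O : Type*} [CommRing O] [IsDomain O] [IsDiscreteValuationRing O]

lemma span_pow_le_maximalIdeal {π : O} (hπ : Irreducible π) {r : ℕ} (hr : 1 ≤ r) :
    Ideal.span {π ^ r} ≤ maximalIdeal O := by
  rw [hπ.maximalIdeal_eq, Ideal.span_singleton_le_span_singleton]
  exact dvd_pow_self π (by lia)

lemma card_quotient_span_pow {π : O} (hπ : Irreducible π) (r : ℕ) :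
    Nat.card (O ⧸ Ideal.span {π ^ r}) = residueCard O ^ r := by
  have h := cardQuot_pow_of_prime (P := maximalIdeal O)
    (IsDiscreteValuationRing.not_a_field O) (i := r)
  rw [hπ.maximalIdeal_eq, Ideal.span_singleton_pow, ← hπ.maximalIdeal_eq] at h
  exact h

lemma two_le_residueCard [Finite (ResidueField O)] : 2 ≤ residueCard O :=
  Finite.one_lt_card

lemma finite_quotient_span_pow [Finite (ResidueField O)] {π : O} (hπ : Irreducible π) (r : ℕ) :
    Finite (O ⧸ Ideal.span {π ^ r}) := by
  apply Nat.finite_of_card_ne_zero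
  rw [card_quotient_span_pow hπ]
  have := two_le_residueCard (O := O)
  positivity

/-- Properties of the reduction of a surjection are counted with multiplicity a power of `q`. -/
lemma card_surjective_reducePi [Finite (ResidueField O)] {π : O} (hπ : Irreducible π) {n ι : ℕ}
    {m r : ℕ} (hm : 1 ≤ m) (hmr : m ≤ r) (h : Ideal.span {π ^ r} ≤ Ideal.span {π ^ m})
    (p : ((Fin n → O) →ₗ[O] (Fin ι → O ⧸ Ideal.span {π ^ m})) → Prop) :
    Nat.card {φ : (Fin n → O) →ₗ[O] (Fin ι → O ⧸ Ideal.span {π ^ r}) //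
        Function.Surjective φ ∧ p (reducePi (Fin ι) h ∘ₗ φ)} =
      Nat.card {φ : (Fin n → O) →ₗ[O] (Fin ι → O ⧸ Ideal.span {π ^ m}) //
        Function.Surjective φ ∧ p φ} * residueCard O ^ ((r - m) * (n * ι)) := by
  have key := card_comp_mul_card (P := Fin n → O) (reducePi (Fin ι) h) (reducePi_surjective _ h)
    (fun φ => Function.Surjective φ ∧ p φ)
  simp only [surjective_reducePi_comp_iff h (span_pow_le_maximalIdeal hπ hm)] at key
  rw [card_linearMap_pi, card_linearMap_pi, card_quotient_span_pow hπ, card_quotient_span_pow hπ,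
    Fintype.card_fin] at key
  have hq : 0 < residueCard O := by have := two_le_residueCard (O := O); lia
  refine Nat.eq_of_mul_eq_mul_right (show 0 < (residueCard O ^ m) ^ (n * ι) by positivity) ?_
  rw [key, mul_assoc, ← pow_mul, ← pow_mul, ← pow_add, ← add_mul, Nat.sub_add_cancel hmr]

/-- By Nakayama every lift of a surjection over the residue field is surjective, so only the number
of lifts enters. -/
lemma card_surjective_span_pow [Finite (ResidueField O)] {π : O} (hπ : Irreducible π) {n ι : ℕ}
    (hι : ι ≤ n) {r : ℕ} (hr : 1 ≤ r) :
    Nat.card {φ : (Fin n → O) →ₗ[O] (Fin ι → O ⧸ Ideal.span {π ^ r}) // Function.Surjective φ} =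
      (∏ i : Fin ι, (residueCard O ^ n - residueCard O ^ (i : ℕ))) *
        residueCard O ^ ((r - 1) * (n * ι)) := by
  have hle := span_pow_le_maximalIdeal hπ hr
  have key := card_comp_mul_card (P := Fin n → O) (reducePi (Fin ι) hle)
    (reducePi_surjective _ hle) (fun φ => Function.Surjective φ)
  simp only [surjective_reducePi_comp_iff hle le_rfl] at key
  rw [card_linearMap_pi, card_linearMap_pi, card_quotient_span_pow hπ, Fintype.card_fin] at key
  have hF : Nat.card {φ : (Fin n → O) →ₗ[O] (Fin ι → O ⧸ maximalIdeal O) //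
      Function.Surjective φ} = _ :=
    card_surjective_field (O := O) (F := ResidueField O) Ideal.Quotient.mk_surjective hι
  rw [hF] at key
  have hq : 0 < residueCard O := by have := two_le_residueCard (O := O); lia
  refine Nat.eq_of_mul_eq_mul_right (show 0 < residueCard O ^ (n * ι) by positivity) ?_
  refine key.trans ?_
  rw [mul_assoc, ← pow_mul, ← pow_add, ← Nat.succ_mul, Nat.succ_eq_add_one, Nat.sub_add_cancel hr]
  rfl

end DVR

/-! ### Elementary divisor types as kernels of surjections. -/

section Types

variable {O : Type*} [CommRing O]

lemma rowSpan_smul {n : ℕ} (c : O) (M : Matrix (Fin n) (Fin n) O) :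
    rowSpan (c • M) = (rowSpan M).map (LinearMap.lsmul O (Fin n → O) c) := by
  rw [rowSpan, rowSpan, Submodule.map_span, ← Set.range_comp]
  rfl

lemma mem_rowSpan {n : ℕ} {M : Matrix (Fin n) (Fin n) O} {x : Fin n → O} :
    x ∈ rowSpan M ↔ ∃ y, Matrix.vecMul y M = x := by
  rw [rowSpan, ← range_vecMulLinear]
  rfl

lemma divisorMatrix_singleton (π : O) (n ι : ℕ) (r : ℕ+) :
    divisorMatrix π n {ι} (fun _ => r) =
      Matrix.diagonal fun k : Fin n => if (k : ℕ) < ι then π ^ (r : ℕ) else 1 := by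
  unfold divisorMatrix
  congr 1
  ext k
  rw [Fintype.sum_unique]
  have : ((default : ↥({ι} : Finset ℕ)) : ℕ) = ι :=
    Finset.mem_singleton.mp (default : ↥({ι} : Finset ℕ)).2
  rw [this]
  split_ifs <;> simp

lemma hasType_iff_zero {π : O} {n : ℕ} {I : Finset ℕ} {r₀ : ℕ} {r : I → ℕ+}
    {Λ : Submodule O (Fin n → O)} :
    HasType π I r₀ r Λ ↔
      ∃ Λ', HasType π I 0 r Λ' ∧ Λ = Λ'.map (LinearMap.lsmul O (Fin n → O) (π ^ r₀)) := by
  have h1 : LinearMap.lsmul O (Fin n → O) 1 = LinearMap.id := by ext; simp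
  simp only [HasType, rowSpan_smul, pow_zero, h1, Submodule.map_id]
  constructor
  · rintro ⟨A, rfl⟩
    exact ⟨_, ⟨A, rfl⟩, rfl⟩
  · rintro ⟨_, ⟨A, rfl⟩, rfl⟩
    exact ⟨A, rfl⟩

/-- The row span of `D A` in terms of the coordinate change given by `A`. -/
lemma mem_rowSpan_divisorMatrix_mul {π : O} {n ι : ℕ} {r : ℕ+} (A : GL (Fin n) O)
    (x : Fin n → O) :
    x ∈ rowSpan (divisorMatrix π n {ι} (fun _ => r) * (A : Matrix (Fin n) (Fin n) O)) ↔
      ∀ k : Fin n, (k : ℕ) < ι →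
        Matrix.vecMul x ((A⁻¹ : GL (Fin n) O) : Matrix (Fin n) (Fin n) O) k ∈
          Ideal.span {π ^ (r : ℕ)} := by
  have hA : (A : Matrix (Fin n) (Fin n) O) * (A⁻¹ : GL (Fin n) O) = 1 := by simp
  have hA' : ((A⁻¹ : GL (Fin n) O) : Matrix (Fin n) (Fin n) O) * A = 1 := by simp
  rw [mem_rowSpan, divisorMatrix_singleton]
  simp only [Ideal.mem_span_singleton']
  constructor
  · rintro ⟨y, rfl⟩ k hk
    rw [Matrix.vecMul_vecMul, Matrix.mul_assoc, hA, Matrix.mul_one,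
      Matrix.vecMul_diagonal, if_pos hk]
    exact ⟨_, rfl⟩
  · intro h
    choose! a ha using h
    refine ⟨fun k => if (k : ℕ) < ι then a k else
      Matrix.vecMul x ((A⁻¹ : GL (Fin n) O) : Matrix (Fin n) (Fin n) O) k, ?_⟩
    rw [← Matrix.vecMul_vecMul]
    have : (Matrix.vecMul (fun k : Fin n => if (k : ℕ) < ι then a k else
        Matrix.vecMul x ((A⁻¹ : GL (Fin n) O) : Matrix (Fin n) (Fin n) O) k)
        (Matrix.diagonal fun k : Fin n => if (k : ℕ) < ι then π ^ (r : ℕ) else 1)) =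
        Matrix.vecMul x ((A⁻¹ : GL (Fin n) O) : Matrix (Fin n) (Fin n) O) := by
      ext k
      rw [Matrix.vecMul_diagonal]
      split_ifs with hk
      · exact ha k hk
      · rw [mul_one]
    rw [this, Matrix.vecMul_vecMul, hA', Matrix.vecMul_one]

/-- A surjection `O ^ n → O ^ ι` consists of coordinates of an automorphism of `O ^ n`. -/
lemma exists_GL_of_surjective [IsDomain O] [IsPrincipalIdealRing O] {n ι : ℕ} (hι : ι ≤ n)
    (M : (Fin n → O) →ₗ[O] (Fin ι → O)) (hM : Function.Surjective M) :
    ∃ A : GL (Fin n) O, ∀ x i, M x i =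
      Matrix.vecMul x ((A⁻¹ : GL (Fin n) O) : Matrix (Fin n) (Fin n) O) (Fin.castLE hι i) := by
  obtain ⟨σ, hσ⟩ := M.exists_rightInverse_of_surjective (LinearMap.range_eq_top.mpr hM)
  replace hσ : ∀ y, M (σ y) = y := fun y => LinearMap.congr_fun hσ y
  -- `M` splits since its target is free. Its kernel is free over the principal ideal domain, and a
  -- basis of it supplies the missing `n - ι` coordinates.
  let e : (Fin n → O) ≃ₗ[O] (Fin ι → O) × M.ker :=
    LinearEquiv.ofLinearMap
      (M.prod ((LinearMap.id - σ ∘ₗ M).codRestrict M.ker fun x => by simp [hσ]))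
      (σ.coprod M.ker.subtype)
      (by ext x <;> simp [hσ]) (by ext x; simp)
  have hrank : Module.finrank O M.ker = Module.finrank O (Fin (n - ι) → O) := by
    have := e.finrank_eq
    rw [Module.finrank_prod] at this
    simp only [Module.finrank_fintype_fun_eq_card, Fintype.card_fin] at this ⊢
    lia
  let g : M.ker ≃ₗ[O] (Fin (n - ι) → O) := LinearEquiv.ofFinrankEq _ _ hrank
  let f : Fin n ≃ Fin ι ⊕ Fin (n - ι) :=
    (finCongr (Nat.add_sub_of_le hι).symm).trans finSumFinEquiv.symm
  let E : (Fin n → O) ≃ₗ[O] (Fin n → O) :=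
    e ≪≫ₗ (LinearEquiv.refl O _).prodCongr g ≪≫ₗ (LinearEquiv.sumArrowLequivProdArrow _ _ O O).symm
      ≪≫ₗ LinearEquiv.funCongrLeft O O f
  have hf : ∀ i : Fin ι, f (Fin.castLE hι i) = Sum.inl i := by
    intro i
    rw [Equiv.trans_apply, Equiv.symm_apply_eq]
    rfl
  have hE : ∀ x i, E x (Fin.castLE hι i) = M x i := by
    intro x i
    simp only [E, LinearEquiv.trans_apply, LinearEquiv.funCongrLeft_apply, LinearMap.funLeft_apply,
      hf]
    rfl
  -- Vectors are rows here, hence the transposes; the matrix of `E` has to be the inverse of `A`.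
  refine ⟨⟨(LinearMap.toMatrix' E.symm.toLinearMap).transpose,
    (LinearMap.toMatrix' E.toLinearMap).transpose, ?_, ?_⟩, fun x i => ?_⟩
  · rw [← Matrix.transpose_mul, ← LinearMap.toMatrix'_comp]
    simp
  · rw [← Matrix.transpose_mul, ← LinearMap.toMatrix'_comp]
    simp
  · rw [← hE]
    change _ = Matrix.vecMul x (LinearMap.toMatrix' E.toLinearMap).transpose _
    rw [Matrix.vecMul_transpose, LinearMap.toMatrix'_mulVec]
    rfl

/-- The submodules of type `({ι}, 0, r)` are the kernels of surjections to `(O / π ^ r) ^ ι`. -/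
lemma hasType_zero_iff [IsDomain O] [IsDiscreteValuationRing O] {π : O} (hπ : Irreducible π)
    {n ι : ℕ} (hι : ι ≤ n) {r : ℕ+} {Λ : Submodule O (Fin n → O)} :
    HasType π {ι} 0 (fun _ => r) Λ ↔
      ∃ φ : (Fin n → O) →ₗ[O] (Fin ι → O ⧸ Ideal.span {π ^ (r : ℕ)}),
        Function.Surjective φ ∧ φ.ker = Λ := by
  simp only [HasType, pow_zero, one_smul]
  constructor
  · rintro ⟨A, rfl⟩
    have hA : Function.Surjective
        ((A⁻¹ : GL (Fin n) O) : Matrix (Fin n) (Fin n) O).vecMulLinear :=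
      fun y => ⟨Matrix.vecMul y (A : Matrix _ _ O), by simp [Matrix.vecMul_vecMul]⟩
    refine ⟨mkPi _ _ ∘ₗ LinearMap.funLeft O O (Fin.castLE hι) ∘ₗ
      ((A⁻¹ : GL (Fin n) O) : Matrix (Fin n) (Fin n) O).vecMulLinear,
      (mkPi_surjective _ _).comp ((LinearMap.funLeft_surjective_of_injective O O _
        (Fin.castLE_injective hι)).comp hA), ?_⟩
    ext x
    rw [LinearMap.mem_ker, mem_rowSpan_divisorMatrix_mul]
    simp only [LinearMap.comp_apply, mkPi_eq_zero]
    constructor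
    · intro h k hk
      exact h ⟨k, hk⟩
    · intro h i
      exact h _ i.2
  · rintro ⟨φ, hφ, rfl⟩
    obtain ⟨M, hM, rfl⟩ := exists_surjective_lift (span_pow_le_maximalIdeal hπ r.pos) φ hφ
    obtain ⟨A, hA⟩ := exists_GL_of_surjective hι M hM
    refine ⟨A, ?_⟩
    ext x
    rw [LinearMap.mem_ker, mem_rowSpan_divisorMatrix_mul]
    simp only [LinearMap.comp_apply, mkPi_eq_zero, hA]
    constructor
    · intro h k hk
      exact h ⟨k, hk⟩
    · intro h i
      exact h _ i.2

end Types

/-! ### The closedness condition and the two ranges of `(r₀, r)`. -/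

section Reduction

variable {O : Type*} [CommRing O]

/-- The kernels of surjections `O ^ n → (O / π ^ r) ^ ι`. -/
def IsSurjectiveKernel (π : O) {n : ℕ} (ι r : ℕ) (Λ : Submodule O (Fin n → O)) : Prop :=
  ∃ φ : (Fin n → O) →ₗ[O] (Fin ι → O ⧸ Ideal.span {π ^ r}), Function.Surjective φ ∧ φ.ker = Λ

/-- Closedness under the componentwise multiplication. -/
def IsMulClosed {n : ℕ} (Λ : Submodule O (Fin n → O)) : Prop :=
  ∀ x ∈ Λ, ∀ y ∈ Λ, x * y ∈ Λ

lemma span_pow_le_span_pow (π : O) {m r : ℕ} (h : m ≤ r) :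
    Ideal.span {π ^ r} ≤ Ideal.span {π ^ m} :=
  Ideal.span_singleton_le_span_singleton.mpr (pow_dvd_pow π h)

lemma pow_smul_pi_eq_zero {π : O} {κ : Type*} {r k : ℕ} (h : r ≤ k)
    (x : κ → O ⧸ Ideal.span {π ^ r}) : π ^ k • x = 0 := by
  obtain ⟨y, rfl⟩ := mkPi_surjective _ _ x
  rw [← map_smul, mkPi_eq_zero]
  intro i
  exact Ideal.mul_mem_right _ _
    (span_pow_le_span_pow π h (Ideal.mem_span_singleton_self _))

lemma pow_smul_mem_ker_iff [IsDomain O] {π : O} (hπ : Irreducible π) {P κ : Type*}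
    [AddCommGroup P] [Module O P] {m k r : ℕ} (h : k + m = r) (hle : Ideal.span {π ^ r} ≤ Ideal.span {π ^ m})
    (φ : P →ₗ[O] (κ → O ⧸ Ideal.span {π ^ r})) (x : P) :
    π ^ k • x ∈ φ.ker ↔ x ∈ (reducePi κ hle ∘ₗ φ).ker := by
  rw [LinearMap.mem_ker, LinearMap.mem_ker, map_smul, LinearMap.comp_apply]
  obtain ⟨y, hy⟩ := mkPi_surjective _ _ (φ x)
  rw [← hy, ← map_smul, reducePi_mkPi, mkPi_eq_zero, mkPi_eq_zero]
  refine forall_congr' fun i => ?_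
  rw [Ideal.mem_span_singleton, Ideal.mem_span_singleton, ← h, pow_add, Pi.smul_apply, smul_eq_mul,
    mul_dvd_mul_iff_left (pow_ne_zero _ hπ.ne_zero)]

/-- The kernel of the reduction is `φ.ker + π ^ m P`: an error in `π ^ m (O / π ^ r) ^ κ` is the
image of some `π ^ m u` because `φ` is onto. -/
lemma exists_of_mem_ker_reducePi {π : O} {P κ : Type*} [AddCommGroup P] [Module O P]
    {m r : ℕ} (hle : Ideal.span {π ^ r} ≤ Ideal.span {π ^ m})
    (φ : P →ₗ[O] (κ → O ⧸ Ideal.span {π ^ r})) (hφ : Function.Surjective φ) {x : P}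
    (hx : x ∈ (reducePi κ hle ∘ₗ φ).ker) : ∃ y ∈ φ.ker, ∃ u, x = y + π ^ m • u := by
  obtain ⟨v, hv⟩ := mkPi_surjective _ _ (φ x)
  rw [LinearMap.mem_ker, LinearMap.comp_apply, ← hv, reducePi_mkPi, mkPi_eq_zero] at hx
  simp only [Ideal.mem_span_singleton] at hx
  choose w hw using hx
  obtain ⟨u, hu⟩ := hφ (mkPi _ _ w)
  refine ⟨x - π ^ m • u, ?_, u, by abel⟩
  rw [LinearMap.mem_ker, map_sub, map_smul, hu, ← hv, ← map_smul, sub_eq_zero]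
  congr 1
  ext i
  exact hw i

/-- Multiplying by `π ^ k` turns membership in `φ.ker` into membership in the kernel of the
reduction. Changing the factors by multiples of `π ^ m` changes the product by such a multiple,
which the reduction kills. -/
lemma isMulClosed_ker_reducePi_iff [IsDomain O] {π : O} (hπ : Irreducible π) {n : ℕ} {κ : Type*}
    {m k r : ℕ} (h : k + m = r) (hle : Ideal.span {π ^ r} ≤ Ideal.span {π ^ m})
    (φ : (Fin n → O) →ₗ[O] (κ → O ⧸ Ideal.span {π ^ r})) (hφ : Function.Surjective φ) :
    (∀ x ∈ φ.ker, ∀ y ∈ φ.ker, π ^ k • (x * y) ∈ φ.ker) ↔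
      IsMulClosed (reducePi κ hle ∘ₗ φ).ker := by
  simp only [pow_smul_mem_ker_iff hπ h hle]
  constructor
  · intro H x hx y hy
    obtain ⟨x', hx', u, rfl⟩ := exists_of_mem_ker_reducePi hle φ hφ hx
    obtain ⟨y', hy', v, rfl⟩ := exists_of_mem_ker_reducePi hle φ hφ hy
    have : (x' + π ^ m • u) * (y' + π ^ m • v) =
        x' * y' + π ^ m • (u * y' + x' * v + π ^ m • (u * v)) := by
      simp only [add_mul, mul_add, smul_mul_assoc, mul_smul_comm, smul_add]
      abel
    rw [this]
    refine Submodule.add_mem _ (H _ hx' _ hy') ?_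
    rw [LinearMap.mem_ker, map_smul]
    exact pow_smul_pi_eq_zero le_rfl _
  · intro H x hx y hy
    exact H x (LinearMap.ker_le_ker_comp _ _ hx) y (LinearMap.ker_le_ker_comp _ _ hy)

variable [IsDomain O] [IsDiscreteValuationRing O] [Finite (ResidueField O)]

/-- A submodule that contains a multiple of `O ^ n` by a power of `π` has finite index. -/
lemma finite_quotient_of_pow_smul_mem {π : O} (hπ : Irreducible π) {n k : ℕ}
    {Λ : Submodule O (Fin n → O)} (h : ∀ x, π ^ k • x ∈ Λ) : Finite ((Fin n → O) ⧸ Λ) := by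
  have := finite_quotient_span_pow hπ k
  have hle : (mkPi (Fin n) (Ideal.span {π ^ k})).ker ≤ Λ := by
    intro x hx
    simp only [LinearMap.mem_ker, mkPi_eq_zero, Ideal.mem_span_singleton] at hx
    choose y hy using hx
    rw [show x = π ^ k • y from funext hy]
    exact h y
  have h1 : Finite ((Fin n → O) ⧸ (mkPi (Fin n) (Ideal.span {π ^ k})).ker) :=
    Finite.of_equiv _ (LinearMap.quotKerEquivOfSurjective _ (mkPi_surjective _ _)).toEquiv.symm
  exact Finite.of_surjective _ (Submodule.factor_surjective hle)

/-- Scaling by `π ^ r₀` is injective, and `(π ^ r₀ x) (π ^ r₀ y) = π ^ r₀ (π ^ r₀ x y)`. Finite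
index costs nothing, since the lattice contains `π ^ (r₀ + r) O ^ n`. -/
lemma typeCount_eq_card {π : O} (hπ : Irreducible π) {n ι : ℕ} (hι : ι ≤ n) (r₀ : ℕ) (r : ℕ+) :
    typeCount π n {ι} r₀ (fun _ => r) = Nat.card {Λ : Submodule O (Fin n → O) //
      IsSurjectiveKernel π ι r Λ ∧ ∀ x ∈ Λ, ∀ y ∈ Λ, π ^ r₀ • (x * y) ∈ Λ} := by
  have hinj : Function.Injective (LinearMap.lsmul O (Fin n → O) (π ^ r₀)) :=
    fun x y h => smul_right_injective _ (pow_ne_zero _ hπ.ne_zero) h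
  have hset : {Λ : Submodule O (Fin n → O) | IsFiniteIndexSubalgebra Λ ∧
      HasType π {ι} r₀ (fun _ => r) Λ} =
      Submodule.map (LinearMap.lsmul O (Fin n → O) (π ^ r₀)) '' {Λ |
        IsSurjectiveKernel π ι r Λ ∧ ∀ x ∈ Λ, ∀ y ∈ Λ, π ^ r₀ • (x * y) ∈ Λ} := by
    have hmul : ∀ Λ : Submodule O (Fin n → O),
        (∀ x ∈ Λ.map (LinearMap.lsmul O (Fin n → O) (π ^ r₀)),
          ∀ y ∈ Λ.map (LinearMap.lsmul O (Fin n → O) (π ^ r₀)),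
            x * y ∈ Λ.map (LinearMap.lsmul O (Fin n → O) (π ^ r₀))) ↔
        ∀ x ∈ Λ, ∀ y ∈ Λ, π ^ r₀ • (x * y) ∈ Λ := by
      intro Λ
      constructor
      · intro h x hx y hy
        obtain ⟨z, hz, hz'⟩ := h _ (Submodule.mem_map_of_mem hx) _ (Submodule.mem_map_of_mem hy)
        have : z = π ^ r₀ • (x * y) := by
          apply hinj
          rw [hz']
          simp only [LinearMap.lsmul_apply, smul_mul_assoc, mul_smul_comm]
        exact this ▸ hz
      · rintro h _ ⟨x, hx, rfl⟩ _ ⟨y, hy, rfl⟩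
        refine ⟨_, h x hx y hy, ?_⟩
        simp only [LinearMap.lsmul_apply, smul_mul_assoc, mul_smul_comm]
    ext Λ
    simp only [Set.mem_ofPred_eq, Set.mem_image, hasType_iff_zero (r₀ := r₀),
      hasType_zero_iff hπ hι]
    constructor
    · rintro ⟨⟨-, h⟩, Λ', hΛ', rfl⟩
      exact ⟨Λ', ⟨hΛ', (hmul Λ').mp h⟩, rfl⟩
    · rintro ⟨Λ', ⟨⟨φ, hφ, rfl⟩, h⟩, rfl⟩
      refine ⟨⟨finite_quotient_of_pow_smul_mem hπ (k := r₀ + r) fun x => ?_, (hmul _).mpr h⟩,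
        _, ⟨φ, hφ, rfl⟩, rfl⟩
      rw [pow_add, mul_smul]
      refine Submodule.mem_map_of_mem (f := LinearMap.lsmul O (Fin n → O) (π ^ r₀)) ?_
      rw [LinearMap.mem_ker, map_smul]
      exact pow_smul_pi_eq_zero le_rfl _
  rw [typeCount, hset, Set.ncard_image_of_injective _ (Submodule.map_injective_of_injective hinj)]
  rfl

/-- All surjections from `O ^ ι` onto `(O / π ^ r) ^ ι` have the same kernel, so there are as many
of them as automorphisms of the target. -/
lemma card_linearEquiv_pi {π : O} (hπ : Irreducible π) {ι r : ℕ} (hr : 1 ≤ r) :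
    Nat.card ((Fin ι → O ⧸ Ideal.span {π ^ r}) ≃ₗ[O] (Fin ι → O ⧸ Ideal.span {π ^ r})) =
      (∏ i : Fin ι, (residueCard O ^ ι - residueCard O ^ (i : ℕ))) *
        residueCard O ^ ((r - 1) * (ι * ι)) := by
  have := finite_quotient_span_pow hπ r
  rw [← card_surjective_span_pow hπ le_rfl hr]
  have key := card_surjective_eq (O := O) (P := Fin ι → O) (N := Fin ι → O ⧸ Ideal.span {π ^ r})
    (fun _ => True)
  simp only [and_true] at key
  rw [key]
  suffices h : Nat.card {Λ : Submodule O (Fin ι → O) // ∃ φ : (Fin ι → O) →ₗ[O]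
      (Fin ι → O ⧸ Ideal.span {π ^ r}), Function.Surjective φ ∧ φ.ker = Λ} = 1 by
    rw [h, one_mul]
  rw [Nat.card_eq_one_iff_unique]
  refine ⟨⟨?_⟩, ⟨⟨_, mkPi _ _, mkPi_surjective _ _, rfl⟩⟩⟩
  have huniq : ∀ φ : (Fin ι → O) →ₗ[O] (Fin ι → O ⧸ Ideal.span {π ^ r}),
      Function.Surjective φ → φ.ker = (mkPi (Fin ι) (Ideal.span {π ^ r})).ker := by
    intro φ hφ
    have hle : (mkPi (Fin ι) (Ideal.span {π ^ r})).ker ≤ φ.ker := by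
      intro x hx
      simp only [LinearMap.mem_ker, mkPi_eq_zero, Ideal.mem_span_singleton] at hx
      choose y hy using hx
      rw [show x = π ^ r • y from funext hy, LinearMap.mem_ker, map_smul]
      exact pow_smul_pi_eq_zero le_rfl _
    -- Both quotients are isomorphic to the same finite module, so the surjection between them is
    -- injective.
    have hinj : Function.Injective (Submodule.factor hle) := by
      have e := ((LinearMap.quotKerEquivOfSurjective _ (mkPi_surjective _ _)).trans
        (LinearMap.quotKerEquivOfSurjective _ hφ).symm).toEquiv
      have hfin : Finite ((Fin ι → O) ⧸ (mkPi (Fin ι) (Ideal.span {π ^ r})).ker) :=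
        Finite.of_equiv _ (LinearMap.quotKerEquivOfSurjective _ (mkPi_surjective _ _)).toEquiv.symm
      have hs : Function.Surjective (e.symm ∘ Submodule.factor hle) :=
        e.symm.surjective.comp (Submodule.factor_surjective hle)
      exact (Finite.injective_iff_surjective.mpr hs).of_comp
    refine le_antisymm (fun x hx => ?_) hle
    have h0 : Submodule.factor hle (Submodule.Quotient.mk x) = Submodule.factor hle 0 := by
      rw [map_zero]
      exact (Submodule.Quotient.mk_eq_zero _).mpr hx
    exact (Submodule.Quotient.mk_eq_zero _).mp (hinj h0)
  rintro ⟨_, φ, hφ, rfl⟩ ⟨_, ψ, hψ, rfl⟩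
  exact Subtype.ext ((huniq φ hφ).trans (huniq ψ hψ).symm)

lemma prod_residueCard_pos {n ι : ℕ} (hι : ι ≤ n) :
    0 < ∏ i : Fin ι, (residueCard O ^ n - residueCard O ^ (i : ℕ)) :=
  Finset.prod_pos fun i _ => Nat.sub_pos_of_lt
    (Nat.pow_lt_pow_right two_le_residueCard (i.2.trans_le hι))

/-- Here `π ^ r₀` kills the target, so every kernel qualifies. The order of `GL_ι` over the residue
field is kept as a factor to avoid division in `ℕ`. -/
lemma typeCount_of_le {π : O} (hπ : Irreducible π) {n ι : ℕ} (hι : ι ≤ n) {r₀ : ℕ} {r : ℕ+}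
    (h : (r : ℕ) ≤ r₀) :
    typeCount π n {ι} r₀ (fun _ => r) *
        ∏ i : Fin ι, (residueCard O ^ ι - residueCard O ^ (i : ℕ)) =
      (∏ i : Fin ι, (residueCard O ^ n - residueCard O ^ (i : ℕ))) *
        residueCard O ^ (((r : ℕ) - 1) * (ι * (n - ι))) := by
  have key := card_surjective_eq (O := O) (P := Fin n → O)
    (N := Fin ι → O ⧸ Ideal.span {π ^ (r : ℕ)})
    (fun Λ => ∀ x ∈ Λ, ∀ y ∈ Λ, π ^ r₀ • (x * y) ∈ Λ)
  have htriv : ∀ φ : (Fin n → O) →ₗ[O] (Fin ι → O ⧸ Ideal.span {π ^ (r : ℕ)}),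
      (Function.Surjective φ ∧ ∀ x ∈ φ.ker, ∀ y ∈ φ.ker, π ^ r₀ • (x * y) ∈ φ.ker) ↔
        Function.Surjective φ := by
    intro φ
    refine and_iff_left fun x _ y _ => ?_
    rw [LinearMap.mem_ker, map_smul]
    exact pow_smul_pi_eq_zero h _
  simp only [htriv] at key
  rw [card_surjective_span_pow hπ hι r.pos, card_linearEquiv_pi hπ r.pos] at key
  rw [typeCount_eq_card hπ hι]
  have hq : 0 < residueCard O := by have := two_le_residueCard (O := O); lia
  refine Nat.eq_of_mul_eq_mul_right
    (show 0 < residueCard O ^ (((r : ℕ) - 1) * (ι * ι)) by positivity) ?_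
  rw [mul_assoc]
  refine key.symm.trans ?_
  rw [mul_assoc, ← pow_add, ← mul_add, ← mul_add, Nat.sub_add_cancel hι, mul_comm ι n]

/-- Surjections of level `r` lift those of level `m` in `q ^ (r₀ n ι)` ways, while the automorphism
group grows by `q ^ (r₀ ι ι)`; the quotient is the stated power. -/
lemma typeCount_of_lt {π : O} (hπ : Irreducible π) {n ι : ℕ} (hι : ι ≤ n) {r₀ m : ℕ} {r : ℕ+}
    (hm : 1 ≤ m) (h : r₀ + m = (r : ℕ)) :
    typeCount π n {ι} r₀ (fun _ => r) =
      Nat.card {Λ : Submodule O (Fin n → O) // IsSurjectiveKernel π ι m Λ ∧ IsMulClosed Λ} *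
        residueCard O ^ (r₀ * (ι * (n - ι))) := by
  have hle := span_pow_le_span_pow π (show m ≤ (r : ℕ) by lia)
  have key := card_surjective_eq (O := O) (P := Fin n → O)
    (N := Fin ι → O ⧸ Ideal.span {π ^ (r : ℕ)})
    (fun Λ => ∀ x ∈ Λ, ∀ y ∈ Λ, π ^ r₀ • (x * y) ∈ Λ)
  have hcl : ∀ φ : (Fin n → O) →ₗ[O] (Fin ι → O ⧸ Ideal.span {π ^ (r : ℕ)}),
      (Function.Surjective φ ∧ ∀ x ∈ φ.ker, ∀ y ∈ φ.ker, π ^ r₀ • (x * y) ∈ φ.ker) ↔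
        Function.Surjective φ ∧ IsMulClosed (reducePi (Fin ι) hle ∘ₗ φ).ker := fun φ =>
    and_congr_right fun hφ => isMulClosed_ker_reducePi_iff hπ h hle φ hφ
  simp only [hcl] at key
  rw [card_surjective_reducePi hπ hm (by lia) hle (fun ψ => IsMulClosed ψ.ker),
    card_surjective_eq (O := O) (P := Fin n → O) (N := Fin ι → O ⧸ Ideal.span {π ^ m}) IsMulClosed,
    card_linearEquiv_pi hπ r.pos, card_linearEquiv_pi hπ hm] at key
  rw [typeCount_eq_card hπ hι]
  have hq : 0 < residueCard O := by have := two_le_residueCard (O := O); lia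
  have hG := prod_residueCard_pos (O := O) (le_refl ι)
  refine Nat.eq_of_mul_eq_mul_right (show 0 < (∏ i : Fin ι, (residueCard O ^ ι -
    residueCard O ^ (i : ℕ))) * residueCard O ^ (((r : ℕ) - 1) * (ι * ι)) by positivity) ?_
  refine key.symm.trans ?_
  have h1 : (r : ℕ) - 1 = r₀ + (m - 1) := by lia
  have h2 : (r : ℕ) - m = r₀ := by lia
  have h3 : n * ι = ι * (n - ι) + ι * ι := by rw [← mul_add, Nat.sub_add_cancel hι, mul_comm]
  rw [h1, h2, h3]
  change Nat.card {Λ : Submodule O (Fin n → O) // IsSurjectiveKernel π ι m Λ ∧ IsMulClosed Λ} * _ *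
    _ = _
  ring

end Reduction

universe u

/-! ### Equivalence relations and Stirling numbers. -/

section Setoids

/-- The function on `Option α` whose fibres are the classes of an extension of `s`. -/
def optionExtend {α : Type*} (s : Setoid α) (o : Option (Quotient s)) (x : Option α) :
    Option (Quotient s) :=
  x.elim o fun a => some ⟦a⟧

/-- An equivalence relation on `Option α` is an equivalence relation on `α`, together with the
choice of a class to which `none` is added, or of none. -/
noncomputable def setoidOptionEquiv (α : Type*) :
    (Σ s : Setoid α, Option (Quotient s)) ≃ Setoid (Option α) :=
  Equiv.ofBijective (fun p => Setoid.ker (optionExtend p.1 p.2)) (by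
    classical
    constructor
    · rintro ⟨s, o⟩ ⟨s', o'⟩ h
      have hr : ∀ x y, optionExtend s o x = optionExtend s o y ↔
          optionExtend s' o' x = optionExtend s' o' y := fun x y => by
        simpa only [Setoid.ker_def] using Setoid.ext_iff.mp h x y
      obtain rfl : s = s' := by
        ext a b
        have := hr (some a) (some b)
        simpa only [optionExtend, Option.elim_some, Option.some.injEq, Quotient.eq] using this
      congr 1
      cases o with
      | none =>
        cases o' with
        | none => rfl
        | some c =>
          obtain ⟨a, rfl⟩ := Quotient.exists_rep c
          have := (hr (some a) none).mpr rfl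
          simp [optionExtend] at this
      | some c =>
        obtain ⟨a, rfl⟩ := Quotient.exists_rep c
        have := (hr (some a) none).mp rfl
        exact this
    · intro t
      by_cases h : ∃ a, t (some a) none
      · obtain ⟨a, ha⟩ := h
        refine ⟨⟨t.comap some, some ⟦a⟧⟩, ?_⟩
        ext x y
        rw [Setoid.ker_def]
        have e : ∀ b c, (⟦b⟧ : Quotient (t.comap some)) = ⟦c⟧ ↔ t (some b) (some c) := fun b c =>
          Quotient.eq
        cases x <;> cases y <;> simp only [optionExtend, Option.elim_some, Option.elim_none,
          Option.some.injEq, e, true_iff]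
        · exact t.refl' _
        · exact ⟨fun h => t.trans' (t.symm' ha) h, fun h => t.trans' ha h⟩
        · exact ⟨fun h => t.trans' h ha, fun h => t.trans' h (t.symm' ha)⟩
      · push Not at h
        refine ⟨⟨t.comap some, none⟩, ?_⟩
        ext x y
        rw [Setoid.ker_def]
        have e : ∀ b c, (⟦b⟧ : Quotient (t.comap some)) = ⟦c⟧ ↔ t (some b) (some c) := fun b c =>
          Quotient.eq
        cases x <;> cases y <;> simp only [optionExtend, Option.elim_some, Option.elim_none,
          Option.some.injEq, e, true_iff, reduceCtorEq, false_iff]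
        · exact t.refl' _
        · exact fun h' => h _ (t.symm' h')
        · exact h _)

lemma card_quotient_setoidOptionEquiv_none {α : Type*} [Finite α] (s : Setoid α) :
    Nat.card (Quotient (setoidOptionEquiv α ⟨s, none⟩)) = Nat.card (Quotient s) + 1 := by
  have hs : Function.Surjective (optionExtend s none) := by
    rintro (_ | c)
    · exact ⟨none, rfl⟩
    · obtain ⟨a, rfl⟩ := Quotient.exists_rep c
      exact ⟨some a, rfl⟩
  rw [← Finite.card_option]
  exact Nat.card_congr (Setoid.quotientKerEquivOfSurjective _ hs)

lemma card_quotient_setoidOptionEquiv_some {α : Type*} (s : Setoid α) (c : Quotient s) :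
    Nat.card (Quotient (setoidOptionEquiv α ⟨s, some c⟩)) = Nat.card (Quotient s) := by
  have hr : Set.range (optionExtend s (some c)) = Set.range (some : Quotient s → _) := by
    ext x
    constructor
    · rintro ⟨_ | a, rfl⟩
      · exact ⟨c, rfl⟩
      · exact ⟨⟦a⟧, rfl⟩
    · rintro ⟨d, rfl⟩
      obtain ⟨a, rfl⟩ := Quotient.exists_rep d
      exact ⟨some a, rfl⟩
  refine (Nat.card_congr (Setoid.quotientKerEquivRange _)).trans ?_
  rw [hr]
  exact Nat.card_range_of_injective (Option.some_injective _)

instance finite_setoid {α : Type*} [Finite α] : Finite (Setoid α) :=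
  Finite.of_injective (fun (s : Setoid α) (a b : α) => s a b) fun _ _ h =>
    Setoid.ext fun a b => iff_of_eq (congrFun (congrFun h a) b)

open Classical in
lemma card_subtype_eq_sum {β : Type*} [Fintype β] (p : β → Prop) :
    Nat.card {b // p b} = ∑ b, if p b then 1 else 0 := by
  rw [Nat.card_eq_fintype_card, Fintype.card_subtype, Finset.card_filter]

/-- The Stirling recurrence: `none` joins one of `k + 1` classes or forms a class of its own. -/
lemma card_setoid_option {α : Type*} [Finite α] (k : ℕ) :
    Nat.card {t : Setoid (Option α) // Nat.card (Quotient t) = k + 1} =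
      (k + 1) * Nat.card {s : Setoid α // Nat.card (Quotient s) = k + 1} +
        Nat.card {s : Setoid α // Nat.card (Quotient s) = k} := by
  classical
  have := Fintype.ofFinite (Setoid α)
  have := fun s : Setoid α => Fintype.ofFinite (Quotient s)
  rw [← Nat.card_congr ((setoidOptionEquiv α).subtypeEquivOfSubtype
    (p := fun t => Nat.card (Quotient t) = k + 1))]
  rw [card_subtype_eq_sum, card_subtype_eq_sum, card_subtype_eq_sum]
  rw [Fintype.sum_sigma, Finset.mul_sum, ← Finset.sum_add_distrib]
  refine Finset.sum_congr rfl fun s _ => ?_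
  simp only [Fintype.sum_option, card_quotient_setoidOptionEquiv_none,
    card_quotient_setoidOptionEquiv_some, Finset.sum_const, Finset.card_univ,
    ← Nat.card_eq_fintype_card, smul_eq_mul, Nat.add_right_cancel_iff]
  rw [add_comm]
  congr 1
  · split_ifs with h
    · rw [h]
    · simp
  · congr

lemma card_setoid_congr {α β : Type*} (e : α ≃ β) (k : ℕ) :
    Nat.card {s : Setoid α // Nat.card (Quotient s) = k} =
      Nat.card {s : Setoid β // Nat.card (Quotient s) = k} := by
  refine Nat.card_congr (Equiv.subtypeEquiv
    ⟨Setoid.comap e.symm, Setoid.comap e, fun s => ?_, fun s => ?_⟩ fun s => ?_)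
  · ext a b
    simp [Setoid.comap_rel]
  · ext a b
    simp [Setoid.comap_rel]
  · rw [Nat.card_congr (Quotient.congr (rb := Setoid.comap e.symm s) e fun a b => ?_)]
    · rfl
    · change s a b ↔ s _ _
      simp

/-- Stirling numbers of the second kind count equivalence relations. -/
lemma card_setoid_eq_stirlingSecond (α : Type u) [Finite α] (k : ℕ) :
    Nat.card {s : Setoid α // Nat.card (Quotient s) = k} =
      Nat.stirlingSecond (Nat.card α) k := by
  induction α using Finite.induction_empty_option generalizing k with
  | of_equiv e ih => rw [← card_setoid_congr e, ih, Nat.card_congr e]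
  | h_empty =>
    have hq : ∀ s : Setoid PEmpty.{u + 1}, Nat.card (Quotient s) = 0 := fun s => by
      have : IsEmpty (Quotient s) := ⟨fun c => c.exists_rep.choose.elim⟩
      exact Nat.card_of_isEmpty
    have : Unique (Setoid PEmpty.{u + 1}) := ⟨⟨⊤⟩, fun s => by ext a; exact a.elim⟩
    simp only [hq, Nat.card_of_isEmpty]
    cases k with
    | zero => simp
    | succ k => simp
  | h_option ih =>
    rw [Finite.card_option]
    cases k with
    | zero =>
      rw [Nat.stirlingSecond_succ_zero, Nat.card_eq_zero]
      refine Or.inl ⟨fun s => ?_⟩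
      have := Finite.card_pos_iff.mpr (⟨⟦none⟧⟩ : Nonempty (Quotient s.1))
      lia
    | succ k => rw [card_setoid_option, ih, ih, Nat.stirlingSecond_succ_succ]

end Setoids

/-! ### The generating function of the Stirling numbers. -/

section Theta

lemma coeff_prod_inv_eq_stirlingSecond (k d : ℕ) :
    PowerSeries.coeff d (∏ i ∈ Finset.Icc 1 k, (1 - (i : PowerSeries ℚ) * PowerSeries.X)⁻¹) =
      (Nat.stirlingSecond (k + d) k : ℚ) := by
  induction k generalizing d with
  | zero =>
    cases d with
    | zero => simp
    | succ d => simp [Nat.stirlingSecond_succ_zero, PowerSeries.coeff_one]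
  | succ k ih =>
    -- Clearing the last factor turns into the Stirling recurrence on coefficients.
    have hprod : (∏ i ∈ Finset.Icc 1 (k + 1), (1 - (i : PowerSeries ℚ) * PowerSeries.X)⁻¹) *
        (1 - PowerSeries.C ((k + 1 : ℕ) : ℚ) * PowerSeries.X) =
        ∏ i ∈ Finset.Icc 1 k, (1 - (i : PowerSeries ℚ) * PowerSeries.X)⁻¹ := by
      rw [Finset.prod_Icc_succ_top (by lia), mul_assoc, map_natCast, PowerSeries.inv_mul_cancel,
        mul_one]
      simp
    induction d with
    | zero => simp [Nat.stirlingSecond_self]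
    | succ d ihd =>
      have h := ih (d + 1)
      rw [← hprod, mul_sub, mul_one, map_sub, ← mul_assoc, PowerSeries.coeff_succ_mul_X,
        PowerSeries.coeff_mul_C, ihd] at h
      rw [show k + 1 + (d + 1) = (k + 1 + d) + 1 by ring, Nat.stirlingSecond_succ_succ]
      rw [sub_eq_iff_eq_add] at h
      rw [h, show k + (d + 1) = k + 1 + d by ring]
      push_cast
      ring

lemma theta_eq_stirlingSecond {n ι : ℕ} (hι : ι ≤ n) :
    theta n ι = Nat.stirlingSecond (n + 1) (n - ι + 1) := by
  rw [theta, coeff_prod_inv_eq_stirlingSecond]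
  congr 2
  lia

end Theta

/-! ### Lattices from equivalence relations and back. -/

section Lattices

variable {O : Type*} [CommRing O] {α : Type*}

/-- Extend a vector by a zero coordinate. -/
def extendZero (x : α → O) (i : Option α) : O := i.elim 0 x

@[simp] lemma extendZero_none (x : α → O) : extendZero x none = 0 := rfl

@[simp] lemma extendZero_some (x : α → O) (i : α) : extendZero x (some i) = x i := rfl

@[simp] lemma extendZero_zero (i : Option α) : extendZero (0 : α → O) i = 0 := by cases i <;> rfl

lemma extendZero_add (x y : α → O) (i : Option α) :
    extendZero (x + y) i = extendZero x i + extendZero y i := by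
  cases i <;> simp

lemma extendZero_mul (x y : α → O) (i : Option α) :
    extendZero (x * y) i = extendZero x i * extendZero y i := by
  cases i <;> simp

lemma extendZero_smul (a : O) (x : α → O) (i : Option α) :
    extendZero (a • x) i = a * extendZero x i := by
  cases i <;> simp

/-- The vectors whose coordinates are congruent modulo `J` on the classes of `t`, and congruent to
zero on the class of `none`. -/
def congruenceLattice (J : Ideal O) (t : Setoid (Option α)) : Submodule O (α → O) where
  carrier := {x | ∀ i j, t i j → extendZero x i - extendZero x j ∈ J}
  zero_mem' i j _ := by simp
  add_mem' {x y} hx hy i j h := by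
    rw [extendZero_add, extendZero_add, add_sub_add_comm]
    exact J.add_mem (hx i j h) (hy i j h)
  smul_mem' a x hx i j h := by
    rw [extendZero_smul, extendZero_smul, ← mul_sub]
    exact J.mul_mem_left _ (hx i j h)

lemma mem_congruenceLattice {J : Ideal O} {t : Setoid (Option α)} {x : α → O} :
    x ∈ congruenceLattice J t ↔ ∀ i j, t i j → extendZero x i - extendZero x j ∈ J := Iff.rfl

lemma mul_mem_congruenceLattice {J : Ideal O} {t : Setoid (Option α)} {x y : α → O}
    (hx : x ∈ congruenceLattice J t) (hy : y ∈ congruenceLattice J t) :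
    x * y ∈ congruenceLattice J t := by
  intro i j h
  rw [extendZero_mul, extendZero_mul,
    show extendZero x i * extendZero y i - extendZero x j * extendZero y j =
      (extendZero x i - extendZero x j) * extendZero y i +
        extendZero x j * (extendZero y i - extendZero y j) by ring]
  exact J.add_mem (J.mul_mem_right _ (hx i j h)) (J.mul_mem_left _ (hy i j h))

/-- Coordinates are related if they agree modulo `J` on `Λ`; the additional coordinate `none` is
zero. -/
def coordinateSetoid (J : Ideal O) (Λ : Submodule O (α → O)) : Setoid (Option α) where
  r i j := ∀ x ∈ Λ, extendZero x i - extendZero x j ∈ J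
  iseqv :=
    { refl := fun i x _ => by simp
      symm := fun {i j} h x hx => by
        rw [← neg_sub]
        exact J.neg_mem (h x hx)
      trans := fun {i j k} h h' x hx => by
        rw [← sub_add_sub_cancel _ (extendZero x j)]
        exact J.add_mem (h x hx) (h' x hx) }

lemma coordinateSetoid_rel {J : Ideal O} {Λ : Submodule O (α → O)} {i j : Option α} :
    coordinateSetoid J Λ i j ↔ ∀ x ∈ Λ, extendZero x i - extendZero x j ∈ J := Iff.rfl

open Classical in
/-- The characteristic vector of a set of coordinates. -/
noncomputable def charVec (O : Type*) [CommRing O] (S : Set α) : α → O := fun i =>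
  if i ∈ S then 1 else 0

lemma charVec_of_mem {S : Set α} {i : α} (h : i ∈ S) : charVec O S i = 1 := if_pos h

lemma charVec_of_notMem {S : Set α} {i : α} (h : i ∉ S) : charVec O S i = 0 := if_neg h

lemma charVec_inter (S T : Set α) : charVec O (S ∩ T) = charVec O S * charVec O T := by
  ext i
  by_cases h : i ∈ S <;> by_cases h' : i ∈ T <;> simp [charVec, h, h']

lemma charVec_diff (S T : Set α) :
    charVec O (S \ T) = charVec O S - charVec O S * charVec O T := by
  ext i
  by_cases h : i ∈ S <;> by_cases h' : i ∈ T <;> simp [charVec, h, h']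

lemma charVec_union (S T : Set α) :
    charVec O (S ∪ T) = charVec O S + charVec O T - charVec O S * charVec O T := by
  ext i
  by_cases h : i ∈ S <;> by_cases h' : i ∈ T <;> simp [charVec, h, h']

open Classical in
lemma extendZero_charVec_class {t : Setoid (Option α)} {i₀ : Option α} (h : ¬ t i₀ none)
    (i : Option α) :
    extendZero (charVec O {c | t (some c) i₀}) i = if t i i₀ then 1 else 0 := by
  cases i with
  | none => rw [if_neg fun h' => h (t.symm' h')]; rfl
  | some c => rfl

lemma charVec_class_mem_congruenceLattice (J : Ideal O) {t : Setoid (Option α)} {i₀ : Option α}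
    (h : ¬ t i₀ none) : charVec O {c | t (some c) i₀} ∈ congruenceLattice J t := by
  intro i j hij
  rw [extendZero_charVec_class h, extendZero_charVec_class h]
  have : t i i₀ ↔ t j i₀ := ⟨fun h' => t.trans' (t.symm' hij) h', fun h' => t.trans' hij h'⟩
  classical
  rw [if_congr this rfl rfl, sub_self]
  exact J.zero_mem

/-- The characteristic vector of a class avoiding `none` lies in the lattice and takes the values 1
on that class and 0 off it, so it witnesses that distinct classes stay distinct modulo a proper
ideal. -/
lemma coordinateSetoid_congruenceLattice {J K : Ideal O} (hJ : J ≤ K) (hK : K ≠ ⊤)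
    (t : Setoid (Option α)) : coordinateSetoid K (congruenceLattice J t) = t := by
  have key : ∀ i j, ¬ t i none → coordinateSetoid K (congruenceLattice J t) i j → t i j := by
    intro i j hi h
    by_contra hij
    have := h _ (charVec_class_mem_congruenceLattice J hi)
    rw [extendZero_charVec_class hi, extendZero_charVec_class hi, if_pos (t.refl' i),
      if_neg fun h' => hij (t.symm' h'), sub_zero] at this
    exact hK ((Ideal.eq_top_iff_one K).mpr this)
  ext i j
  refine ⟨fun h => ?_, fun h x hx => hJ (hx i j h)⟩
  by_cases hi : t i none
  · by_cases hj : t j none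
    · exact t.trans' hi (t.symm' hj)
    · exact t.symm' (key j i hj (Setoid.symm' _ h))
  · exact key i j hi h

end Lattices

/-! ### The rank of a congruence lattice. -/

section Counting

variable {O : Type*} [CommRing O] {n : ℕ}

/-- Letting `none` represent its own class ensures that all nonrepresentatives are genuine
coordinates. -/
lemma exists_representative {α : Type*} (t : Setoid (Option α)) :
    ∃ ρ : Option α → Option α, (∀ i, t (ρ i) i) ∧ (∀ i j, t i j → ρ i = ρ j) ∧ ρ none = none := by
  classical
  refine ⟨fun i => if t i none then none else (⟦i⟧ : Quotient t).out, fun i => ?_, fun i j h => ?_,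
    if_pos (t.refl' none)⟩
  · dsimp only
    split_ifs with h
    · exact t.symm' h
    · exact Quotient.mk_out i
  · have h1 : t i none ↔ t j none := ⟨fun h' => t.trans' (t.symm' h) h', fun h' => t.trans' h h'⟩
    have h2 : (⟦i⟧ : Quotient t) = ⟦j⟧ := Quotient.sound h
    simp only [h1, h2]

/-- The lattice is given by one congruence `x c ≡ x (ρ c)` for each nonrepresentative `c`. There are
`n + 1` points and one representative per class, so `ι` congruences; they are independent, since the
coordinates `x c` can be prescribed with all representatives set to zero. -/
lemma isSurjectiveKernel_congruenceLattice {π : O} {m : ℕ} {ι : ℕ}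
    (t : Setoid (Option (Fin n))) (ht : Nat.card (Quotient t) + ι = n + 1) :
    IsSurjectiveKernel π ι m (congruenceLattice (Ideal.span {π ^ m}) t) := by
  classical
  obtain ⟨ρ, hρ, hρ', hρ0⟩ := exists_representative t
  have hρρ : ∀ i, ρ (ρ i) = ρ i := fun i => hρ' _ _ (hρ i)
  have hfix : Nat.card {i // ρ i = i} = Nat.card (Quotient t) := by
    refine Nat.card_congr (Equiv.ofBijective (fun i => ⟦i.1⟧) ⟨fun i j h => ?_, fun c => ?_⟩)
    · have := hρ' _ _ (Quotient.exact h)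
      rw [i.2, j.2] at this
      exact Subtype.ext this
    · obtain ⟨i, rfl⟩ := Quotient.exists_rep c
      exact ⟨⟨ρ i, hρρ i⟩, Quotient.sound (hρ i)⟩
  have hnfix : Nat.card {i // ¬ ρ i = i} = Nat.card {c : Fin n // ρ (some c) ≠ some c} := by
    refine (Nat.card_congr (Equiv.ofBijective
      (fun c : {c : Fin n // ρ (some c) ≠ some c} => (⟨some c.1, c.2⟩ : {i // ¬ ρ i = i}))
      ⟨fun c d h => ?_, ?_⟩)).symm
    · exact Subtype.ext (Option.some.inj (congrArg Subtype.val h))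
    · rintro ⟨_ | c, hc⟩
      · exact absurd hρ0 hc
      · exact ⟨⟨c, hc⟩, rfl⟩
  have hsum : Nat.card {i // ρ i = i} + Nat.card {i // ¬ ρ i = i} = n + 1 := by
    rw [← Nat.card_sum, Nat.card_congr (Equiv.sumCompl fun i => ρ i = i), Finite.card_option,
      Nat.card_fin]
  have hcard : Nat.card {c : Fin n // ρ (some c) ≠ some c} = ι := by lia
  let e : Fin ι ≃ {c : Fin n // ρ (some c) ≠ some c} := (Finite.equivFinOfCardEq hcard).symm
  let M : (Fin n → O) →ₗ[O] (Fin ι → O) :=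
    { toFun := fun x k => x (e k).1 - extendZero x (ρ (some (e k).1))
      map_add' := fun x y => by
        ext k
        simp only [extendZero_add, Pi.add_apply]
        ring
      map_smul' := fun a x => by
        ext k
        simp only [extendZero_smul, Pi.smul_apply, smul_eq_mul, RingHom.id_apply]
        ring }
  have hM : Function.Surjective M := by
    intro y
    let x : Fin n → O := fun c => if h : ρ (some c) ≠ some c then y (e.symm ⟨c, h⟩) else 0
    have hx : ∀ i, extendZero x (ρ i) = 0 := by
      intro i
      rcases h : ρ i with _ | c
      · rfl
      · have : ρ (some c) = some c := by rw [← h, hρρ]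
        simp [x, this]
    refine ⟨x, funext fun k => ?_⟩
    change x (e k).1 - extendZero x (ρ (some (e k).1)) = y k
    have : ρ (some (e k).1) ≠ some (e k).1 := (e k).2
    rw [hx, sub_zero]
    simp only [x, dif_pos this, Subtype.coe_eta, Equiv.symm_apply_apply]
  refine ⟨mkPi _ _ ∘ₗ M, (mkPi_surjective _ _).comp hM, ?_⟩
  ext x
  rw [LinearMap.mem_ker, LinearMap.comp_apply, mkPi_eq_zero, mem_congruenceLattice]
  constructor
  · intro h
    have key : ∀ i, extendZero x i - extendZero x (ρ i) ∈ Ideal.span {π ^ m} := by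
      intro i
      by_cases hi : ρ i = i
      · simp [hi]
      · rcases i with _ | c
        · exact absurd hρ0 hi
        · have := h (e.symm ⟨c, hi⟩)
          change x (e _).1 - extendZero x (ρ (some (e _).1)) ∈ _ at this
          rwa [Equiv.apply_symm_apply] at this
    intro i j hij
    have := Ideal.sub_mem _ (key i) (key j)
    rw [hρ' i j hij] at this
    simpa using this
  · intro h k
    exact h (some (e k).1) _ (Setoid.symm' _ (hρ _))

/-- The quotient by `Λ` has `q ^ (m ι)` elements. -/
lemma IsSurjectiveKernel.rank_unique [IsDomain O] [IsDiscreteValuationRing O]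
    [Finite (ResidueField O)] {π : O} (hπ : Irreducible π) {m ι ι' : ℕ} (hm : 1 ≤ m)
    {Λ : Submodule O (Fin n → O)} (h : IsSurjectiveKernel π ι m Λ)
    (h' : IsSurjectiveKernel π ι' m Λ) : ι = ι' := by
  obtain ⟨φ, hφ, rfl⟩ := h
  obtain ⟨ψ, hψ, hker⟩ := h'
  have e := (φ.quotKerEquivOfSurjective hφ).symm ≪≫ₗ Submodule.quotEquivOfEq _ _ hker.symm ≪≫ₗ
    ψ.quotKerEquivOfSurjective hψ
  have := Nat.card_congr e.toEquiv
  simp only [Nat.card_fun, card_quotient_span_pow hπ, Nat.card_eq_fintype_card,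
    Fintype.card_fin] at this
  exact Nat.pow_right_injective (Nat.le_self_pow (by lia) _ |>.trans' two_le_residueCard) this

end Counting

/-! ### Multiplicatively closed kernels are congruence lattices. -/

section Structure

variable {O : Type*} [CommRing O]

/-- A power that sends units to `1` and nonunits to `0` modulo `π ^ m`. -/
lemma exists_pow_sub_mem [IsDomain O] [IsDiscreteValuationRing O] [Finite (ResidueField O)]
    {π : O} (hπ : Irreducible π) (m : ℕ) :
    ∃ E : ℕ, 1 ≤ E ∧ ∀ a : O, (IsUnit a → a ^ E - 1 ∈ Ideal.span {π ^ m}) ∧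
      (¬ IsUnit a → a ^ E ∈ Ideal.span {π ^ m}) := by
  have := finite_quotient_span_pow hπ m
  have hpos : 0 < Nat.card (O ⧸ Ideal.span {π ^ m})ˣ := Nat.card_pos
  -- A multiple of the order of the unit group sends units to 1, and an exponent of at least `m`
  -- sends nonunits to 0.
  refine ⟨(m + 1) * Nat.card (O ⧸ Ideal.span {π ^ m})ˣ, Nat.mul_pos (by lia) hpos,
    fun a => ⟨fun ha => ?_, fun ha => ?_⟩⟩
  · rw [← Ideal.Quotient.eq_zero_iff_mem, map_sub, map_pow, map_one, sub_eq_zero, mul_comm, pow_mul]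
    obtain ⟨u, hu⟩ := ha.map (Ideal.Quotient.mk (Ideal.span {π ^ m}))
    rw [← hu, ← Units.val_pow_eq_pow_val, pow_card_eq_one', Units.val_one, one_pow]
  · have ha' : a ∈ maximalIdeal O := (mem_maximalIdeal a).mpr ha
    rw [hπ.maximalIdeal_eq, Ideal.mem_span_singleton] at ha'
    rw [Ideal.mem_span_singleton]
    exact (pow_dvd_pow π (by nlinarith)).trans (pow_dvd_pow_of_dvd ha' _)

lemma pow_mem_of_isMulClosed {n : ℕ} {Λ : Submodule O (Fin n → O)} (hc : IsMulClosed Λ)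
    {x : Fin n → O} (hx : x ∈ Λ) {E : ℕ} (hE : 1 ≤ E) : x ^ E ∈ Λ := by
  induction E, hE using Nat.le_induction with
  | base => rwa [pow_one]
  | succ E _ ih =>
    rw [pow_succ]
    exact hc _ ih _ hx

variable {π : O} {n ι m : ℕ} {Λ : Submodule O (Fin n → O)}

lemma IsSurjectiveKernel.mem_of_forall_mem (hΛ : IsSurjectiveKernel π ι m Λ) {x : Fin n → O}
    (hx : ∀ i, x i ∈ Ideal.span {π ^ m}) : x ∈ Λ := by
  obtain ⟨φ, -, rfl⟩ := hΛ
  simp only [Ideal.mem_span_singleton] at hx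
  choose y hy using hx
  rw [show x = π ^ m • y from funext hy, LinearMap.mem_ker, map_smul]
  exact pow_smul_pi_eq_zero le_rfl _

lemma IsSurjectiveKernel.mem_of_sub_mem (hΛ : IsSurjectiveKernel π ι m Λ) {x y : Fin n → O}
    (hx : x ∈ Λ) (h : ∀ i, x i - y i ∈ Ideal.span {π ^ m}) : y ∈ Λ := by
  rw [← sub_sub_cancel x y]
  exact Λ.sub_mem hx (hΛ.mem_of_forall_mem h)

lemma IsSurjectiveKernel.exists_of_pow_smul_mem [IsDomain O] (hπ : Irreducible π)
    (hΛ : IsSurjectiveKernel π ι m Λ) {k l : ℕ} (h : k + l = m) {x : Fin n → O}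
    (hx : π ^ k • x ∈ Λ) : ∃ y ∈ Λ, ∃ u, x = y + π ^ l • u := by
  obtain ⟨φ, hφ, rfl⟩ := hΛ
  have hle := span_pow_le_span_pow π (show l ≤ m by lia)
  exact exists_of_mem_ker_reducePi hle φ hφ ((pow_smul_mem_ker_iff hπ h hle φ x).mp hx)

variable [IsDomain O] [IsDiscreteValuationRing O]

lemma charVec_unit_mem [Finite (ResidueField O)] (hπ : Irreducible π)
    (hΛ : IsSurjectiveKernel π ι m Λ) (hc : IsMulClosed Λ) {x : Fin n → O} (hx : x ∈ Λ) :
    charVec O {i | IsUnit (x i)} ∈ Λ := by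
  obtain ⟨E, hE, h⟩ := exists_pow_sub_mem hπ m
  refine hΛ.mem_of_sub_mem (pow_mem_of_isMulClosed hc hx hE) fun i => ?_
  rw [Pi.pow_apply]
  by_cases hi : IsUnit (x i)
  · rw [charVec_of_mem (by exact hi)]
    exact (h _).1 hi
  · rw [charVec_of_notMem (by exact hi), sub_zero]
    exact (h _).2 hi

lemma mem_iff_of_charVec_mem {S : Set (Fin n)} (hS : charVec O S ∈ Λ) {i j : Fin n}
    (h : coordinateSetoid (maximalIdeal O) Λ (some i) (some j)) : i ∈ S ↔ j ∈ S := by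
  have := h _ hS
  by_cases hi : i ∈ S <;> by_cases hj : j ∈ S <;>
    simp_all [charVec_of_mem, charVec_of_notMem]

lemma not_rel_none_of_charVec_mem {S : Set (Fin n)} (hS : charVec O S ∈ Λ) {i : Fin n}
    (hi : i ∈ S) : ¬ coordinateSetoid (maximalIdeal O) Λ (some i) none := by
  intro h
  have := h _ hS
  simp_all [charVec_of_mem]

/-- A vector of `Λ` supported on a single class that vanishes at one coordinate of that class
vanishes modulo `π ^ m`. -/
lemma dvd_of_supported_on_class (hπ : Irreducible π) (hΛ : IsSurjectiveKernel π ι m Λ)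
    {i : Option (Fin n)} {z : Fin n → O} (hz : z ∈ Λ) (hi : extendZero z i = 0)
    (hsupp : ∀ c, ¬ coordinateSetoid (maximalIdeal O) Λ (some c) i → z c = 0) (c : Fin n) :
    π ^ m ∣ z c := by
  have key : ∀ k ≤ m, ∀ c, π ^ k ∣ z c := by
    intro k
    induction k with
    | zero => simp
    | succ k ih =>
      intro hk c
      choose w hw using ih (by lia)
      have hzw : z = π ^ k • w := funext hw
      -- This uses that `O ^ n / Λ` is free over `O / π ^ m`: from `π ^ k w ∈ Λ`, the vector `w` is
      -- in `Λ` up to `π ^ (m - k)`, hence modulo `π`. So `w c ≡ w i = 0` modulo `π`, which gains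
      -- one power.
      obtain ⟨y, hy, u, hu⟩ :=
        hΛ.exists_of_pow_smul_mem hπ (Nat.add_sub_of_le (show k ≤ m by lia)) (hzw ▸ hz)
      by_cases hci : coordinateSetoid (maximalIdeal O) Λ (some c) i
      · have hdvd : ∀ a, π ∣ π ^ (m - k) * a := fun a =>
          (dvd_pow_self π (by lia)).mul_right a
        have hwi : extendZero w i = 0 := by
          rw [hzw, extendZero_smul] at hi
          exact (mul_eq_zero.mp hi).resolve_left (pow_ne_zero _ hπ.ne_zero)
        rw [hu, extendZero_add, extendZero_smul] at hwi
        have h1 : π ∣ extendZero y i := by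
          rw [eq_neg_of_add_eq_zero_left hwi, dvd_neg]
          exact hdvd _
        have h2 := hci y hy
        rw [hπ.maximalIdeal_eq, Ideal.mem_span_singleton, extendZero_some] at h2
        have h3 : π ∣ w c := by
          rw [hu]
          exact dvd_add ((dvd_iff_dvd_of_dvd_sub h2).mpr h1) (hdvd _)
        rw [hw c, pow_succ]
        exact mul_dvd_mul_left _ h3
      · rw [hsupp c hci]
        exact dvd_zero _
  exact key m le_rfl c

variable [Finite (ResidueField O)]

lemma exists_charVec_mem (hπ : Irreducible π) (hΛ : IsSurjectiveKernel π ι m Λ)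
    (hc : IsMulClosed Λ) {i : Fin n}
    (hi : ¬ coordinateSetoid (maximalIdeal O) Λ (some i) none) :
    ∃ S : Set (Fin n), charVec O S ∈ Λ ∧ i ∈ S := by
  rw [coordinateSetoid_rel] at hi
  push Not at hi
  obtain ⟨x, hx, h⟩ := hi
  refine ⟨_, charVec_unit_mem hπ hΛ hc hx, ?_⟩
  simpa using h

lemma exists_charVec_mem_separating (hπ : Irreducible π) (hΛ : IsSurjectiveKernel π ι m Λ)
    (hc : IsMulClosed Λ) {i j : Fin n}
    (hi : ¬ coordinateSetoid (maximalIdeal O) Λ (some i) none)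
    (hij : ¬ coordinateSetoid (maximalIdeal O) Λ (some j) (some i)) :
    ∃ S : Set (Fin n), charVec O S ∈ Λ ∧ i ∈ S ∧ j ∉ S := by
  rw [coordinateSetoid_rel] at hij
  push Not at hij
  obtain ⟨x, hx, h⟩ := hij
  simp only [extendZero_some] at h
  by_cases hxi : IsUnit (x i)
  · by_cases hxj : IsUnit (x j)
    -- The coordinate of this vector at `c` is `(x c - x j) * x c`: a unit at `i` and zero at `j`.
    · have hy : x * x - x j • x ∈ Λ := Λ.sub_mem (hc x hx x hx) (Λ.smul_mem _ hx)
      refine ⟨_, charVec_unit_mem hπ hΛ hc hy, ?_, ?_⟩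
      · have h' : IsUnit (x j - x i) := by simpa using h
        simp only [Set.mem_ofPred_eq, Pi.sub_apply, Pi.mul_apply, Pi.smul_apply, smul_eq_mul]
        rw [← sub_mul, ← neg_sub]
        exact h'.neg.mul hxi
      · simp
    · exact ⟨_, charVec_unit_mem hπ hΛ hc hx, hxi, hxj⟩
  · have hxj : IsUnit (x j) := by
      by_contra hxj
      exact h (Ideal.sub_mem _ ((mem_maximalIdeal _).mpr hxj) ((mem_maximalIdeal _).mpr hxi))
    obtain ⟨S, hS, hiS⟩ := exists_charVec_mem hπ hΛ hc hi
    refine ⟨S \ {c | IsUnit (x c)}, ?_, ⟨hiS, hxi⟩, fun h => h.2 hxj⟩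
    have hU := charVec_unit_mem hπ hΛ hc hx
    rw [charVec_diff]
    exact Λ.sub_mem hS (hc _ hS _ hU)

/-- The class of `i` is the intersection of sets separating `i` from each coordinate outside it;
intersections correspond to products. -/
lemma charVec_class_mem (hπ : Irreducible π) (hΛ : IsSurjectiveKernel π ι m Λ)
    (hc : IsMulClosed Λ) {i : Fin n}
    (hi : ¬ coordinateSetoid (maximalIdeal O) Λ (some i) none) :
    charVec O {c | coordinateSetoid (maximalIdeal O) Λ (some c) (some i)} ∈ Λ := by
  classical
  have key : ∀ T : Finset (Fin n), ∃ S : Set (Fin n), charVec O S ∈ Λ ∧ i ∈ S ∧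
      ∀ j ∈ T, j ∈ S → coordinateSetoid (maximalIdeal O) Λ (some j) (some i) := by
    intro T
    induction T using Finset.induction_on with
    | empty =>
      obtain ⟨S, hS, hiS⟩ := exists_charVec_mem hπ hΛ hc hi
      exact ⟨S, hS, hiS, by simp⟩
    | insert j T _ ih =>
      obtain ⟨S, hS, hiS, h⟩ := ih
      by_cases hij : coordinateSetoid (maximalIdeal O) Λ (some j) (some i)
      · refine ⟨S, hS, hiS, fun c hcT hcS => ?_⟩
        rcases Finset.mem_insert.mp hcT with rfl | hcT
        · exact hij
        · exact h c hcT hcS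
      · obtain ⟨S', hS', hiS', hjS'⟩ := exists_charVec_mem_separating hπ hΛ hc hi hij
        refine ⟨S ∩ S', charVec_inter (O := O) S S' ▸ hc _ hS _ hS', ⟨hiS, hiS'⟩,
          fun c hcT hcS => ?_⟩
        rcases Finset.mem_insert.mp hcT with rfl | hcT
        · exact absurd hcS.2 hjS'
        · exact h c hcT hcS.1
  obtain ⟨S, hS, hiS, h⟩ := key Finset.univ
  have : {c | coordinateSetoid (maximalIdeal O) Λ (some c) (some i)} = S := by
    ext c
    exact ⟨fun hc' => (mem_iff_of_charVec_mem hS hc').mpr hiS, h c (Finset.mem_univ c)⟩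
  rwa [this]

/-- The same for unions: each coordinate not related to `none` lies in some set with characteristic
vector in `Λ`, and no such set meets the class of `none`. -/
lemma charVec_not_rel_none_mem (hπ : Irreducible π) (hΛ : IsSurjectiveKernel π ι m Λ)
    (hc : IsMulClosed Λ) :
    charVec O {c | ¬ coordinateSetoid (maximalIdeal O) Λ (some c) none} ∈ Λ := by
  classical
  have key : ∀ T : Finset (Fin n), ∃ S : Set (Fin n), charVec O S ∈ Λ ∧
      ∀ j ∈ T, ¬ coordinateSetoid (maximalIdeal O) Λ (some j) none → j ∈ S := by
    intro T
    induction T using Finset.induction_on with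
    | empty =>
      refine ⟨∅, ?_, by simp⟩
      rw [show charVec O (∅ : Set (Fin n)) = 0 from funext fun i => charVec_of_notMem (by simp)]
      exact Λ.zero_mem
    | insert j T _ ih =>
      obtain ⟨S, hS, h⟩ := ih
      by_cases hj : coordinateSetoid (maximalIdeal O) Λ (some j) none
      · refine ⟨S, hS, fun c hcT hcn => ?_⟩
        rcases Finset.mem_insert.mp hcT with rfl | hcT
        · exact absurd hj hcn
        · exact h c hcT hcn
      · obtain ⟨S', hS', hjS'⟩ := exists_charVec_mem hπ hΛ hc hj
        refine ⟨S ∪ S', ?_, fun c hcT hcn => ?_⟩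
        · rw [charVec_union]
          exact Λ.sub_mem (Λ.add_mem hS hS') (hc _ hS _ hS')
        · rcases Finset.mem_insert.mp hcT with rfl | hcT
          · exact Or.inr hjS'
          · exact Or.inl (h c hcT hcn)
  obtain ⟨S, hS, h⟩ := key Finset.univ
  have : {c | ¬ coordinateSetoid (maximalIdeal O) Λ (some c) none} = S := by
    ext c
    exact ⟨h c (Finset.mem_univ c), not_rel_none_of_charVec_mem hS⟩
  rwa [this]

/-- Multiplying by characteristic vectors isolates one class, and subtracting a multiple of its
characteristic vector creates a zero there. Then `dvd_of_supported_on_class` lifts the congruence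
from modulo `π` to modulo `π ^ m`. -/
lemma le_congruenceLattice (hπ : Irreducible π) (hΛ : IsSurjectiveKernel π ι m Λ)
    (hc : IsMulClosed Λ) :
    Λ ≤ congruenceLattice (Ideal.span {π ^ m}) (coordinateSetoid (maximalIdeal O) Λ) := by
  intro x hx
  have key : ∀ (i : Option (Fin n)) (c : Fin n),
      coordinateSetoid (maximalIdeal O) Λ (some c) i →
        x c - extendZero x i ∈ Ideal.span {π ^ m} := by
    intro i c hci
    rw [Ideal.mem_span_singleton]
    by_cases hi : coordinateSetoid (maximalIdeal O) Λ i none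
    · have hN := charVec_not_rel_none_mem hπ hΛ hc
      -- This vector is `x` on the class of `none` and zero elsewhere; its zero coordinate is the
      -- artificial one at `none`.
      have hz := Λ.sub_mem hx (hc _ hx _ hN)
      have hcn := Setoid.trans' _ hci hi
      have h0 : ∀ a : Fin n, coordinateSetoid (maximalIdeal O) Λ (some a) none → π ^ m ∣ x a := by
        intro a ha
        have := dvd_of_supported_on_class hπ hΛ hz (i := none) rfl (fun b hb => by
          rw [Pi.sub_apply, Pi.mul_apply, charVec_of_mem hb, mul_one, sub_self]) a
        rwa [Pi.sub_apply, Pi.mul_apply, charVec_of_notMem (by simpa using ha), mul_zero,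
          sub_zero] at this
      refine dvd_sub (h0 c hcn) ?_
      rcases i with _ | a
      · exact dvd_zero _
      · exact h0 a hi
    · rcases i with _ | a
      · exact absurd (Setoid.refl' _ _) hi
      · have hC := charVec_class_mem hπ hΛ hc hi
        have hz := Λ.sub_mem (hc _ hx _ hC) (Λ.smul_mem (x a) hC)
        have := dvd_of_supported_on_class hπ hΛ hz (i := some a) (by
          simp [charVec_of_mem (O := O)
            (show a ∈ {c | coordinateSetoid (maximalIdeal O) Λ (some c) (some a)} from
              Setoid.refl' (coordinateSetoid (maximalIdeal O) Λ) (some a))]) (fun b hb => by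
          simp [charVec_of_notMem (O := O) (show b ∉
            {c | coordinateSetoid (maximalIdeal O) Λ (some c) (some a)} from hb)]) c
        simpa [charVec_of_mem (O := O) (show c ∈
            {c | coordinateSetoid (maximalIdeal O) Λ (some c) (some a)} from hci)] using this
  intro i j hij
  rcases i with _ | c
  · rcases j with _ | d
    · simp
    · rw [← neg_sub]
      exact neg_mem (key none d (Setoid.symm' _ hij))
  · exact key j c hij

/-- Modulo `π ^ m`, a vector of the lattice is a combination of characteristic vectors of classes.
The induction removes one class at a time from the support. -/
lemma congruenceLattice_le (hπ : Irreducible π) (hΛ : IsSurjectiveKernel π ι m Λ)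
    (hc : IsMulClosed Λ) :
    congruenceLattice (Ideal.span {π ^ m}) (coordinateSetoid (maximalIdeal O) Λ) ≤ Λ := by
  classical
  have key : ∀ (T : Finset (Fin n)) (x : Fin n → O),
      x ∈ congruenceLattice (Ideal.span {π ^ m}) (coordinateSetoid (maximalIdeal O) Λ) →
      (∀ i ∉ T, x i ∈ Ideal.span {π ^ m}) → x ∈ Λ := by
    intro T
    induction T using Finset.induction_on with
    | empty => exact fun x _ h => hΛ.mem_of_forall_mem fun i => h i (by simp)
    | insert i T _ ih =>
      intro x hx h
      by_cases hi : coordinateSetoid (maximalIdeal O) Λ (some i) none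
      · refine ih x hx fun j hj => ?_
        by_cases hji : j = i
        · simpa [hji] using hx _ _ hi
        · exact h j (by simp [hji, hj])
      · have hC := charVec_class_mem hπ hΛ hc hi
        set C := {c | coordinateSetoid (maximalIdeal O) Λ (some c) (some i)} with hCdef
        have hxC : x * charVec O C ∈ Λ := by
          refine hΛ.mem_of_sub_mem (Λ.smul_mem (x i) hC) fun c => ?_
          rw [Pi.smul_apply, Pi.mul_apply, smul_eq_mul, ← sub_mul]
          by_cases hcC : c ∈ C
          · exact Ideal.mul_mem_right _ _ (hx (some i) (some c) (Setoid.symm' _ hcC))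
          · simp [charVec_of_notMem hcC]
        have hy : x - x * charVec O C ∈ Λ := by
          refine ih _ (Submodule.sub_mem _ hx (mul_mem_congruenceLattice hx
            (charVec_class_mem_congruenceLattice _ hi))) fun j hj => ?_
          rw [Pi.sub_apply, Pi.mul_apply]
          by_cases hjC : j ∈ C
          · simp [charVec_of_mem hjC]
          · have hji : j ≠ i := by
              rintro rfl
              exact hjC (Setoid.refl' (coordinateSetoid (maximalIdeal O) Λ) (some j))
            simpa [charVec_of_notMem hjC] using h j (by simp [hji, hj])
        simpa using Λ.add_mem hy hxC
  exact fun x hx => key Finset.univ x hx (by simp)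

/-- Multiplicatively closed kernels of surjections correspond to equivalence relations. -/
lemma card_isMulClosed (hπ : Irreducible π) (hm : 1 ≤ m) (hι : ι ≤ n) :
    Nat.card {Λ : Submodule O (Fin n → O) // IsSurjectiveKernel π ι m Λ ∧ IsMulClosed Λ} =
      Nat.stirlingSecond (n + 1) (n - ι + 1) := by
  have hcard := card_setoid_eq_stirlingSecond (Option (Fin n)) (n - ι + 1)
  rw [Finite.card_option, Nat.card_fin] at hcard
  rw [← hcard]
  have h1 : ∀ t : Setoid (Option (Fin n)),
      coordinateSetoid (maximalIdeal O) (congruenceLattice (Ideal.span {π ^ m}) t) = t :=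
    coordinateSetoid_congruenceLattice (span_pow_le_maximalIdeal hπ hm)
      (maximalIdeal.isMaximal O).ne_top
  have h2 : ∀ Λ : Submodule O (Fin n → O), IsSurjectiveKernel π ι m Λ ∧ IsMulClosed Λ →
      congruenceLattice (Ideal.span {π ^ m}) (coordinateSetoid (maximalIdeal O) Λ) = Λ :=
    fun Λ h => le_antisymm (congruenceLattice_le hπ h.1 h.2) (le_congruenceLattice hπ h.1 h.2)
  have hpos : ∀ t : Setoid (Option (Fin n)), Nat.card (Quotient t) ≤ n + 1 := fun t => by
    have := Nat.card_le_card_of_surjective (Quotient.mk t) Quotient.mk_surjective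
    rwa [Finite.card_option, Nat.card_fin] at this
  refine Nat.card_congr ⟨fun Λ => ⟨coordinateSetoid (maximalIdeal O) Λ.1, ?_⟩,
    fun t => ⟨congruenceLattice (Ideal.span {π ^ m}) t.1,
      isSurjectiveKernel_congruenceLattice t.1 (by rw [t.2]; lia),
      fun x hx y hy => mul_mem_congruenceLattice hx hy⟩,
    fun Λ => Subtype.ext (h2 _ Λ.2), fun t => Subtype.ext (h1 _)⟩
  -- The number of classes is forced: `Λ` is a kernel both of rank `ι` and of the rank determined by
  -- its relation.
  have hle := hpos (coordinateSetoid (maximalIdeal O) Λ.1)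
  have h := isSurjectiveKernel_congruenceLattice (π := π) (m := m)
    (coordinateSetoid (maximalIdeal O) Λ.1) (Nat.add_sub_of_le hle)
  rw [h2 _ Λ.2] at h
  have := h.rank_unique hπ hm Λ.2.1
  lia

end Structure

/-! ### Compactness yields a finite residue field. -/

section Residue

lemma finite_residueField_of_isAdic {O : Type*} [CommRing O] [IsLocalRing O] [TopologicalSpace O]
    [CompactSpace O] (hO : IsAdic (maximalIdeal O)) : Finite (ResidueField O) := by
  have hring : IsTopologicalRing O := by
    have : NonarchimedeanRing O := by
      rw [IsAdic] at hO
      subst hO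
      exact Ideal.nonarchimedean _
    exact this.toIsTopologicalRing
  have hopen : IsOpen ((maximalIdeal O).toAddSubgroup : Set O) := by
    refine AddSubgroup.isOpen_of_mem_nhds _ (g := 0)
      (hO.hasBasis_nhds_zero.mem_iff.mpr ⟨1, trivial, ?_⟩)
    rw [pow_one]
    rfl
  exact AddSubgroup.quotient_finite_of_isOpen _ hopen

end Residue

/-! ### The coefficients as complex numbers. -/

section Coefficients

lemma stirlingSecond_pos {k : ℕ} (hk : 1 ≤ k) (d : ℕ) : 0 < Nat.stirlingSecond (k + d) k := by
  obtain ⟨k, rfl⟩ := Nat.exists_eq_add_of_le' hk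
  induction d with
  | zero => simp [Nat.stirlingSecond_self]
  | succ d ih =>
    rw [← add_assoc, Nat.stirlingSecond_succ_succ]
    positivity

lemma theta_ne_zero {n ι : ℕ} (hι : ι ≤ n) : (theta n ι : ℂ) ≠ 0 := by
  have h := stirlingSecond_pos (k := n - ι + 1) (by lia) ι
  rw [show n - ι + 1 + ι = n + 1 by lia] at h
  rw [theta_eq_stirlingSecond hι]
  exact_mod_cast h.ne'

lemma one_sub_natCast_pow_ne_zero {q : ℕ} (hq : 2 ≤ q) {k : ℕ} (hk : k ≠ 0) :
    1 - (q : ℂ) ^ k ≠ 0 := by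
  rw [sub_ne_zero]
  have := Nat.one_lt_pow hk (show 1 < q by lia)
  exact_mod_cast this.ne

lemma gaussianBinomial_ne_zero {n ι q : ℕ} (hι : ι ≤ n) (hq : 2 ≤ q) :
    gaussianBinomial n ι q ≠ 0 := by
  refine Finset.prod_ne_zero_iff.mpr fun i hi => ?_
  have := Finset.mem_range.mp hi
  exact div_ne_zero (one_sub_natCast_pow_ne_zero hq (by lia))
    (one_sub_natCast_pow_ne_zero hq (by lia))

/-- Each factor is `q ^ k - q ^ i = -q ^ i (1 - q ^ (k - i))`, and `-q ^ i` is common to both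
products. -/
lemma gaussianBinomial_mul_prod {n ι q : ℕ} (hι : ι ≤ n) (hq : 2 ≤ q) :
    gaussianBinomial n ι q * ((∏ i : Fin ι, (q ^ ι - q ^ (i : ℕ)) : ℕ) : ℂ) =
      ((∏ i : Fin ι, (q ^ n - q ^ (i : ℕ)) : ℕ) : ℂ) := by
  have hsub : ∀ k, ∀ i : Fin ι, ι ≤ k → ((q ^ k - q ^ (i : ℕ) : ℕ) : ℂ) =
      - ((q : ℂ) ^ (i : ℕ) * (1 - (q : ℂ) ^ (k - i))) := by
    intro k i hk
    have hi := i.2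
    rw [Nat.cast_sub (Nat.pow_le_pow_right (by lia) (by lia)), mul_sub, ← pow_add,
      Nat.add_sub_of_le (by lia)]
    push_cast
    ring
  rw [gaussianBinomial, Finset.prod_range, Nat.cast_prod, Nat.cast_prod, ← Finset.prod_mul_distrib]
  refine Finset.prod_congr rfl fun i _ => ?_
  have hi := i.2
  rw [hsub ι i le_rfl, hsub n i hι]
  have := one_sub_natCast_pow_ne_zero hq (show ι - (i : ℕ) ≠ 0 by lia)
  field_simp

variable {O : Type*} [CommRing O] [IsDomain O] [IsDiscreteValuationRing O]
  [Finite (ResidueField O)]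

lemma typeCount_cast_of_le {π : O} (hπ : Irreducible π) {n ι : ℕ} (hι : ι ≤ n) {r₀ : ℕ} {r : ℕ+}
    (h : (r : ℕ) ≤ r₀) :
    (typeCount π n {ι} r₀ (fun _ => r) : ℂ) = gaussianBinomial n ι (residueCard O) *
      ((residueCard O : ℂ) ^ (ι * (n - ι))) ^ ((r : ℕ) - 1) := by
  have key := congrArg (Nat.cast (R := ℂ)) (typeCount_of_le hπ hι h)
  rw [Nat.cast_mul, Nat.cast_mul, ← gaussianBinomial_mul_prod hι two_le_residueCard] at key
  have hG : ((∏ i : Fin ι, (residueCard O ^ ι - residueCard O ^ (i : ℕ)) : ℕ) : ℂ) ≠ 0 :=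
    Nat.cast_ne_zero.mpr (prod_residueCard_pos (O := O) (le_refl ι)).ne'
  apply mul_right_cancel₀ hG
  rw [key, ← pow_mul, mul_comm (ι * (n - ι))]
  push_cast
  ring

lemma typeCount_cast_of_lt {π : O} (hπ : Irreducible π) {n ι : ℕ} (hι : ι ≤ n) {r₀ : ℕ} {r : ℕ+}
    (h : r₀ < (r : ℕ)) :
    (typeCount π n {ι} r₀ (fun _ => r) : ℂ) = (theta n ι : ℂ) *
      ((residueCard O : ℂ) ^ (ι * (n - ι))) ^ r₀ := by
  have hm : 1 ≤ (r : ℕ) - r₀ := by lia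
  rw [typeCount_of_lt hπ hι hm (by lia), card_isMulClosed hπ hm hι, theta_eq_stirlingSecond hι,
    ← pow_mul, mul_comm (ι * (n - ι))]
  push_cast
  ring

end Coefficients

/-! ### Summation of the double series. -/

section Series

/-- Pairs of natural numbers, separated by whether the first is larger. -/
def prodSplitEquiv : (ℕ × ℕ) ⊕ (ℕ × ℕ) ≃ ℕ × ℕ where
  toFun := Sum.elim (fun p => (p.2 + 1 + p.1, p.2)) (fun p => (p.2, p.2 + p.1))
  invFun p := if p.2 < p.1 then Sum.inl (p.1 - (p.2 + 1), p.2) else Sum.inr (p.2 - p.1, p.1)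
  left_inv := by
    rintro (⟨i, j⟩ | ⟨i, j⟩)
    · have h : j < j + 1 + i := by lia
      simp [h]
    · simp
  right_inv := by
    rintro ⟨a, b⟩
    dsimp only
    split_ifs with h
    · simp only [Sum.elim_inl, Prod.mk.injEq, and_true]
      lia
    · simp only [Sum.elim_inr, Prod.mk.injEq, true_and]
      lia

lemma hasSum_geometric_prod {u w : ℂ} (hu : ‖u‖ < 1) (hw : ‖w‖ < 1) (c : ℂ) :
    HasSum (fun p : ℕ × ℕ => c * (u ^ p.1 * w ^ p.2)) (c * ((1 - u)⁻¹ * (1 - w)⁻¹)) := by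
  refine HasSum.mul_left c ((hasSum_geometric_of_norm_lt_one hu).mul
    (hasSum_geometric_of_norm_lt_one hw) ?_)
  exact summable_mul_of_summable_norm (summable_norm_geometric_of_norm_lt_one hu)
    (summable_norm_geometric_of_norm_lt_one hw)

/-- Restricting to either axis leaves a single geometric series. -/
lemma norm_lt_one_of_summable_geometric_prod {u w c : ℂ} (hc : c ≠ 0)
    (h : Summable fun p : ℕ × ℕ => c * (u ^ p.1 * w ^ p.2)) : ‖u‖ < 1 ∧ ‖w‖ < 1 := by
  have h' := (summable_mul_left_iff hc).mp h
  constructor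
  · have := h'.comp_injective (i := fun i : ℕ => (i, 0)) fun a b hab => congrArg Prod.fst hab
    simpa [Function.comp_def] using this
  · have := h'.comp_injective (i := fun i : ℕ => (0, i)) fun a b hab => congrArg Prod.snd hab
    simpa [Function.comp_def] using this

/-- The double series with geometric terms on both sides of the diagonal. -/
lemma summable_iff_and_hasSum_of_diagonal {X Y Q b t : ℂ} (hX : X ≠ 0) (hY : Y ≠ 0) (hb : b ≠ 0)
    (ht : t ≠ 0) {f : ℕ × ℕ → ℂ}
    (h₁ : ∀ k j, j < k → f (k, j) = X ^ k * Y ^ (j + 1) * (b * Q ^ j))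
    (h₂ : ∀ k j, k ≤ j → f (k, j) = X ^ k * Y ^ (j + 1) * (t * Q ^ k)) :
    (Summable f ↔ ‖X‖ < 1 ∧ ‖Y‖ < 1 ∧ ‖X * Y * Q‖ < 1) ∧
      (Summable f → HasSum f
        (Y / (1 - X * Y * Q) * (b * (X / (1 - X)) + t * (1 / (1 - Y))))) := by
  -- The index `j` stands for `r - 1`, so `r ≤ r₀` reads `j < k`. In each region one geometric
  -- variable is `X * Y * Q`, moving along the diagonal, and the other measures the distance from
  -- it.
  have e₁ : ∀ p : ℕ × ℕ, f (prodSplitEquiv (Sum.inl p)) =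
      (b * X * Y) * (X ^ p.1 * (X * Y * Q) ^ p.2) := by
    rintro ⟨i, j⟩
    refine (h₁ _ _ (by lia)).trans ?_
    ring
  have e₂ : ∀ p : ℕ × ℕ, f (prodSplitEquiv (Sum.inr p)) =
      (t * Y) * (Y ^ p.1 * (X * Y * Q) ^ p.2) := by
    rintro ⟨i, j⟩
    refine (h₂ _ _ (by lia)).trans ?_
    ring
  have hnec : Summable f → ‖X‖ < 1 ∧ ‖Y‖ < 1 ∧ ‖X * Y * Q‖ < 1 := by
    intro h
    have h1 := h.comp_injective (prodSplitEquiv.injective.comp Sum.inl_injective)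
    have h2 := h.comp_injective (prodSplitEquiv.injective.comp Sum.inr_injective)
    simp only [Function.comp_def, e₁] at h1
    simp only [Function.comp_def, e₂] at h2
    have g1 := norm_lt_one_of_summable_geometric_prod (mul_ne_zero (mul_ne_zero hb hX) hY) h1
    have g2 := norm_lt_one_of_summable_geometric_prod (mul_ne_zero ht hY) h2
    exact ⟨g1.1, g2.1, g1.2⟩
  have hsuff : ‖X‖ < 1 ∧ ‖Y‖ < 1 ∧ ‖X * Y * Q‖ < 1 → HasSum f
      (Y / (1 - X * Y * Q) * (b * (X / (1 - X)) + t * (1 / (1 - Y)))) := by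
    rintro ⟨hx, hy, hw⟩
    have s1 := hasSum_geometric_prod hx hw (b * X * Y)
    have s2 := hasSum_geometric_prod hy hw (t * Y)
    simp only [← e₁] at s1
    simp only [← e₂] at s2
    have := (HasSum.sum (f := fun p => f (prodSplitEquiv p)) s1 s2)
    rw [show (Y / (1 - X * Y * Q) * (b * (X / (1 - X)) + t * (1 / (1 - Y)))) =
      b * X * Y * ((1 - X)⁻¹ * (1 - X * Y * Q)⁻¹) + t * Y * ((1 - Y)⁻¹ * (1 - X * Y * Q)⁻¹) by ring]
    exact prodSplitEquiv.hasSum_iff.mp this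
  exact ⟨⟨hnec, fun h => (hsuff h).summable⟩, fun h => hsuff (hnec h)⟩

end Series

/-- Reindexing of the terms of the series `Ξ` for a singleton by pairs of natural numbers. -/
def indexEquiv (ι : ℕ) : ℕ × ℕ ≃ ℕ × (({ι} : Finset ℕ) → ℕ+) :=
  (Equiv.refl ℕ).prodCongr (Equiv.pnatEquivNat.symm.trans (Equiv.funUnique _ ℕ+).symm)

lemma xiTerm_indexEquiv {O : Type*} [CommRing O] [IsLocalRing O] (hq : residueCard O ≠ 0) (π : O)
    (n ι : ℕ) (s₀ s : ℂ) (k j : ℕ) :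
    xiTerm π n {ι} s₀ (fun _ => s) (indexEquiv ι (k, j)) =
      ((residueCard O : ℂ) ^ (-((n : ℂ) * s₀))) ^ k *
        ((residueCard O : ℂ) ^ (-((ι : ℂ) * s))) ^ (j + 1) *
        (typeCount π n {ι} k (fun _ => j.succPNat) : ℂ) := by
  have hq' : (residueCard O : ℂ) ≠ 0 := Nat.cast_ne_zero.mpr hq
  have hd : ((default : ↥({ι} : Finset ℕ)) : ℕ) = ι :=
    Finset.mem_singleton.mp (default : ↥({ι} : Finset ℕ)).2
  change (residueCard O : ℂ) ^ (-(s₀ * n * k) -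
    ∑ i : ↥({ι} : Finset ℕ), ((j.succPNat : ℕ) : ℂ) * ((i : ℕ) : ℂ) * s) *
      (typeCount π n {ι} k (fun _ => j.succPNat) : ℂ) = _
  rw [Fintype.sum_unique, hd, ← Complex.cpow_nat_mul, ← Complex.cpow_nat_mul,
    ← Complex.cpow_add _ _ hq']
  congr 2
  push_cast [Nat.succPNat_coe]
  ring

lemma norm_natCast_cpow_lt_one_iff {q : ℕ} (hq : 2 ≤ q) (z : ℂ) :
    ‖(q : ℂ) ^ z‖ < 1 ↔ z.re < 0 := by
  rw [Complex.norm_natCast_cpow_of_pos (by lia)]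
  have h : (1 : ℝ) < q := by exact_mod_cast hq
  rw [Real.rpow_lt_one_iff_of_pos (by positivity)]
  simp [h, h.not_gt]

end CotypeZeta

theorem mainTheorem1 {O : Type*} [CommRing O] [IsDomain O] [IsDiscreteValuationRing O]
    [TopologicalSpace O] [CompactSpace O] (hO : IsAdic (IsLocalRing.maximalIdeal O))
    (π : O) (hπ : Irreducible π) (q : ℕ) (hq : q = Nat.card (IsLocalRing.ResidueField O))
    (n ι : ℕ) (hn : 2 ≤ n) (hι : 1 ≤ ι) (hιn : ι ≤ n - 1) (s₀ s : ℂ) :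
    (Summable (CotypeZeta.xiTerm π n {ι} s₀ (fun _ => s)) ↔
      0 < s₀.re ∧ 0 < s.re ∧ (ι : ℝ) * ((n : ℝ) - (ι : ℝ)) < (n : ℝ) * s₀.re + (ι : ℝ) * s.re) ∧
    (Summable (CotypeZeta.xiTerm π n {ι} s₀ (fun _ => s)) →
      CotypeZeta.xi π n {ι} s₀ (fun _ => s) =
        (q : ℂ) ^ (-((ι : ℂ) * s)) /
            (1 - (q : ℂ) ^ (-((n : ℂ) * s₀) - (ι : ℂ) * s + (ι : ℂ) * ((n : ℂ) - (ι : ℂ)))) *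
          (CotypeZeta.gaussianBinomial n ι (q : ℂ) *
              ((q : ℂ) ^ (-((n : ℂ) * s₀)) / (1 - (q : ℂ) ^ (-((n : ℂ) * s₀)))) +
            (CotypeZeta.theta n ι : ℂ) * (1 / (1 - (q : ℂ) ^ (-((ι : ℂ) * s)))))) := by
  have hfin := CotypeZeta.finite_residueField_of_isAdic hO
  obtain rfl : q = CotypeZeta.residueCard O := hq
  have hq2 := CotypeZeta.two_le_residueCard (O := O)
  have hιn' : ι ≤ n := by lia
  have hq0 : (CotypeZeta.residueCard O : ℂ) ≠ 0 := Nat.cast_ne_zero.mpr (by lia)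
  -- The exponent `ι * (n - ι)` is a natural number on the left, where truncated subtraction is
  -- harmless because `ι ≤ n`.
  have hW : (CotypeZeta.residueCard O : ℂ) ^ (-((n : ℂ) * s₀)) *
      (CotypeZeta.residueCard O : ℂ) ^ (-((ι : ℂ) * s)) *
      (CotypeZeta.residueCard O : ℂ) ^ (ι * (n - ι)) =
      (CotypeZeta.residueCard O : ℂ) ^
        (-((n : ℂ) * s₀) - (ι : ℂ) * s + (ι : ℂ) * ((n : ℂ) - (ι : ℂ))) := by
    rw [← Complex.cpow_natCast, ← Complex.cpow_add _ _ hq0, ← Complex.cpow_add _ _ hq0,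
      Nat.cast_mul, Nat.cast_sub hιn', ← sub_eq_add_neg]
  obtain ⟨h₁, h₂⟩ := CotypeZeta.summable_iff_and_hasSum_of_diagonal
    (X := (CotypeZeta.residueCard O : ℂ) ^ (-((n : ℂ) * s₀)))
    (Y := (CotypeZeta.residueCard O : ℂ) ^ (-((ι : ℂ) * s)))
    (Q := (CotypeZeta.residueCard O : ℂ) ^ (ι * (n - ι)))
    (f := CotypeZeta.xiTerm π n {ι} s₀ (fun _ => s) ∘ CotypeZeta.indexEquiv ι)
    (by simp [Complex.cpow_eq_zero_iff, hq0]) (by simp [Complex.cpow_eq_zero_iff, hq0])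
    (CotypeZeta.gaussianBinomial_ne_zero hιn' hq2) (CotypeZeta.theta_ne_zero hιn')
    (fun k j h => by
      rw [Function.comp_apply, CotypeZeta.xiTerm_indexEquiv (by lia),
        CotypeZeta.typeCount_cast_of_le hπ hιn' (by rw [Nat.succPNat_coe]; lia)]
      rfl)
    (fun k j h => by
      rw [Function.comp_apply, CotypeZeta.xiTerm_indexEquiv (by lia),
        CotypeZeta.typeCount_cast_of_lt hπ hιn' (by rw [Nat.succPNat_coe]; lia)])
  rw [hW] at h₁ h₂
  rw [Equiv.summable_iff] at h₁ h₂
  refine ⟨h₁.trans ?_, fun h => ((CotypeZeta.indexEquiv ι).hasSum_iff.mp (h₂ h)).tsum_eq⟩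
  rw [CotypeZeta.norm_natCast_cpow_lt_one_iff hq2, CotypeZeta.norm_natCast_cpow_lt_one_iff hq2,
    CotypeZeta.norm_natCast_cpow_lt_one_iff hq2]
  have hn0 : (0 : ℝ) < n := by exact_mod_cast (show 0 < n by lia)
  have hι0 : (0 : ℝ) < ι := by exact_mod_cast hι
  have e₁ : (-((n : ℂ) * s₀)).re = -(n * s₀.re) := by simp
  have e₂ : (-((ι : ℂ) * s)).re = -(ι * s.re) := by simp
  have e₃ : (-((n : ℂ) * s₀) - (ι : ℂ) * s + (ι : ℂ) * ((n : ℂ) - (ι : ℂ))).re =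
      -(n * s₀.re) - ι * s.re + ι * (n - ι) := by simp
  rw [e₁, e₂, e₃, neg_lt_zero, neg_lt_zero, mul_pos_iff_of_pos_left hn0,
    mul_pos_iff_of_pos_left hι0]
  refine and_congr_right fun _ => and_congr_right fun _ => ?_
  constructor <;> intro h <;> linarith
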